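/- An input of the decision problem Committee Election with Candidate Attribute Constraints (CECAC) consists of a finite set $C$ of candidates, a finite set $A$ of attributes, a finite collection $R$ of constraints, a profit $S(c)\in\mathbb{Z}$ and a set of attributes $\alpha(c)\subseteq A$ for each candidate $c\in C$, and two positive integers $k\le |C|$ and $p$. Each constraint has the form $\varphi\rightarrow\psi$, where $\varphi$ and $\psi$ are propositional formulas built with $\wedge$ and $\vee$ from literals $a$ and $\overline{a}$ with $a\in A$. A set $W\subseteq C$ makes the attribute $a$ true if some $c\in W$ has $a\in\alpha(c)$, and false otherwise; $W$ satisfies a constraint if the constraint, read as a material implication, is true under this assignment. The question is whether there is a committee $W\subseteq C$ with $|W|=k$ that satisfies all constraints in $R$ and has $\sum_{c\in W}S(c)\ge p$. For $a\in A$ let $N(a)$ be the total number of occurrences of the literals $a$ and $\overline{a}$ in $R$. Theorem. CECAC can be solved in polynomial time on the inputs that fulfil the following two conditions: 1) each candidate has at most one attribute: $|\alpha(c)|\le 1$ for all $c\in C$; 2) each attribute occurs at most once in the constraints: $N(a)\le 1$ for all $a\in A$. That is, some (deterministic, multi-tape) Turing machine, started on an encoding of any such input in which numbers are written in binary, halts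 with the correct yes/no answer after a number of steps that is bounded by a polynomial in the length of the encoding. -/

import Mathlib

namespace CECAC

/-- Propositional formulas over a set `A` of attributes: built with `∧` and `∨` from the literals
`a` (`pos a`) and `ā` (`neg a`). -/
inductive Formula (A : Type) : Type
  | pos (a : A) : Formula A
  | neg (a : A) : Formula A
  | and (q r : Formula A) : Formula A
  | or (q r : Formula A) : Formula A

/-- Truth of a formula under an assignment `v` of truth values to the attributes. -/
def Formula.Holds {A : Type} (v : A → Prop) : Formula A → Prop
  | .pos a => v a
  | .neg a => ¬ v a
  | .and q r => q.Holds v ∧ r.Holds v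
  | .or q r => q.Holds v ∨ r.Holds v

/-- The number of occurrences of the literals `a` and `ā` in a formula. -/
def Formula.occ {A : Type} [DecidableEq A] (a : A) : Formula A → ℕ
  | .pos b => if b = a then 1 else 0
  | .neg b => if b = a then 1 else 0
  | .and q r => q.occ a + r.occ a
  | .or q r => q.occ a + r.occ a

/-- A constraint `lhs → rhs`. -/
structure Constraint (A : Type) : Type where
  lhs : Formula A
  rhs : Formula A

/-- Truth of a constraint, read as a material implication. -/
def Constraint.Holds {A : Type} (v : A → Prop) (r : Constraint A) : Prop :=
  r.lhs.Holds v → r.rhs.Holds v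

/-- The number of occurrences of the literals `a` and `ā` in a constraint. -/
def Constraint.occ {A : Type} [DecidableEq A] (a : A) (r : Constraint A) : ℕ :=
  r.lhs.occ a + r.rhs.occ a

/-- An input of the problem Committee Election with Candidate Attribute Constraints. -/
structure Instance : Type where
  /-- the number of candidates; the candidate set `C` is `Fin m` -/
  m : ℕ
  /-- the number of attributes; the attribute set `A` is `Fin l` -/
  l : ℕ
  /-- the constraints -/
  R : List (Constraint (Fin l))
  /-- the profits (possibly negative) -/
  S : Fin m → ℤ
  /-- the sets of attributes of the candidates -/
  α : Fin m → Finset (Fin l)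
  /-- the committee size -/
  k : ℕ
  /-- the profit bound -/
  p : ℕ
  k_pos : 0 < k
  k_le : k ≤ m
  p_pos : 0 < p

namespace Instance

/-- The assignment set by a committee `W`: an attribute is true if and only if some member of `W`
owns it. -/
def assignment (I : Instance) (W : Finset (Fin I.m)) (a : Fin I.l) : Prop :=
  ∃ c ∈ W, a ∈ I.α c

/-- `W` is a committee of size `k` that satisfies all constraints and has total profit at
least `p`. -/
def IsSolution (I : Instance) (W : Finset (Fin I.m)) : Prop :=
  W.card = I.k ∧ (∀ r ∈ I.R, r.Holds (I.assignment W)) ∧ (I.p : ℤ) ≤ ∑ c ∈ W, I.S c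

/-- The question of the decision problem. -/
def IsYes (I : Instance) : Prop := ∃ W : Finset (Fin I.m), I.IsSolution W

/-- `N(a)`: the number of occurrences of `a` or `ā` in the constraints. -/
def N (I : Instance) (a : Fin I.l) : ℕ := (I.R.map (Constraint.occ a)).sum

end Instance

/-! ### The encoding of inputs as words over a finite alphabet -/

/-- The input alphabet. -/
inductive Sym : Type
  | bit (b : Bool)
  | fin
  | plus
  | minus
  | pos
  | neg
  | and
  | or
  | imp
  | cand
  | attr
  deriving DecidableEq, Fintype

/-- A natural number: its binary digits (lowest first) and an end marker. -/
def encNat (n : ℕ) : List Sym := (Computability.encodeNat n).map Sym.bit ++ [Sym.fin]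

/-- An integer: its sign and its absolute value in binary. -/
def encInt (z : ℤ) : List Sym := (if 0 ≤ z then Sym.plus else Sym.minus) :: encNat z.natAbs

/-- A formula in Polish notation, an attribute being given by its index in binary. -/
def encFormula {l : ℕ} : Formula (Fin l) → List Sym
  | .pos a => Sym.pos :: encNat a
  | .neg a => Sym.neg :: encNat a
  | .and q r => Sym.and :: (encFormula q ++ encFormula r)
  | .or q r => Sym.or :: (encFormula q ++ encFormula r)

/-- A constraint in Polish notation. -/
def encConstraint {l : ℕ} (r : Constraint (Fin l)) : List Sym :=
  Sym.imp :: (encFormula r.lhs ++ encFormula r.rhs)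

/-- A candidate: the list of its attributes (each once, by increasing index), then its profit. -/
def encCandidate {l : ℕ} (s : Finset (Fin l)) (z : ℤ) : List Sym :=
  Sym.cand :: ((s.sort).flatMap (fun a : Fin l => Sym.attr :: encNat a) ++ encInt z)

/-- An input: the number of attributes, the committee size and the profit bound in binary, the list
of the constraints and the list of the candidates. -/
def Instance.encode (I : Instance) : List Sym :=
  encNat I.l ++ encNat I.k ++ encNat I.p ++ I.R.flatMap encConstraint ++
    (List.finRange I.m).flatMap (fun c => encCandidate (I.α c) (I.S c))

/-- Auxiliary: `encNat` is uniquely decodable. -/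
theorem encNat_append_inj {n n' : ℕ} {s s' : List Sym} (h : encNat n ++ s = encNat n' ++ s') :
    n = n' ∧ s = s' := by
  have key : ∀ (x y : List Bool), x.map Sym.bit ++ Sym.fin :: s = y.map Sym.bit ++ Sym.fin :: s' →
      x = y ∧ s = s' := by
    intro x
    induction x with
    | nil => intro y h; cases y <;> simp_all
    | cons b x ih =>
      intro y h
      cases y with
      | nil => simp at h
      | cons c y =>
        simp only [List.map_cons, List.cons_append, List.cons.injEq, Sym.bit.injEq] at h
        obtain ⟨h1, h2⟩ := ih y h.2
        exact ⟨by rw [h.1, h1], h2⟩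
  obtain ⟨h1, h2⟩ := key _ _ (by simpa [encNat] using h)
  refine ⟨?_, h2⟩
  rw [← Computability.decode_encodeNat n, h1, Computability.decode_encodeNat]

/-- Auxiliary: `encInt` is uniquely decodable. -/
theorem encInt_append_inj {z z' : ℤ} {s s' : List Sym} (h : encInt z ++ s = encInt z' ++ s') :
    z = z' ∧ s = s' := by
  simp only [encInt, List.cons_append, List.cons.injEq] at h
  obtain ⟨h0, h1⟩ := h
  obtain ⟨h1, h2⟩ := encNat_append_inj h1
  refine ⟨?_, h2⟩
  split_ifs at h0 <;> omega

/-- Auxiliary: `encFormula` is uniquely decodable. -/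
theorem encFormula_append_inj {l : ℕ} (q : Formula (Fin l)) : ∀ {q' : Formula (Fin l)}
    {s s' : List Sym}, encFormula q ++ s = encFormula q' ++ s' → q = q' ∧ s = s' := by
  induction q with
  | pos a =>
    intro q' s s' h
    cases q' <;> simp only [encFormula, List.cons_append, List.cons.injEq, reduceCtorEq,
      false_and, true_and] at h
    obtain ⟨h1, h2⟩ := encNat_append_inj h
    exact ⟨by rw [Fin.ext h1], h2⟩
  | neg a =>
    intro q' s s' h
    cases q' <;> simp only [encFormula, List.cons_append, List.cons.injEq, reduceCtorEq,
      false_and, true_and] at h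
    obtain ⟨h1, h2⟩ := encNat_append_inj h
    exact ⟨by rw [Fin.ext h1], h2⟩
  | and q r ihq ihr =>
    intro q' s s' h
    cases q' <;> simp only [encFormula, List.cons_append, List.cons.injEq, reduceCtorEq,
      false_and, true_and, List.append_assoc] at h
    obtain ⟨h1, h2⟩ := ihq h
    obtain ⟨h3, h4⟩ := ihr h2
    exact ⟨by rw [h1, h3], h4⟩
  | or q r ihq ihr =>
    intro q' s s' h
    cases q' <;> simp only [encFormula, List.cons_append, List.cons.injEq, reduceCtorEq,
      false_and, true_and, List.append_assoc] at h
    obtain ⟨h1, h2⟩ := ihq h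
    obtain ⟨h3, h4⟩ := ihr h2
    exact ⟨by rw [h1, h3], h4⟩

/-- Auxiliary: a list of uniquely decodable blocks that all begin with the same symbol `t`, and are
followed by something that does not begin with `t`, is uniquely decodable. -/
theorem flatMap_append_inj {β : Type} {t : Sym} {e : β → List Sym}
    (he : ∀ x y s s', e x ++ s = e y ++ s' → x = y ∧ s = s')
    {s s' : List Sym} (hs : s.head? ≠ some t) (hs' : s'.head? ≠ some t) :
    ∀ xs ys : List β, xs.flatMap (fun x => t :: e x) ++ s = ys.flatMap (fun x => t :: e x) ++ s' →
      xs = ys ∧ s = s' := by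
  intro xs
  induction xs with
  | nil =>
    intro ys h
    cases ys with
    | nil => simpa using h
    | cons y ys => exact absurd (by simp_all) hs
  | cons x xs ih =>
    intro ys h
    cases ys with
    | nil => exact absurd (by simp_all [eq_comm]) hs'
    | cons y ys =>
      simp only [List.flatMap_cons, List.cons_append, List.append_assoc, List.cons.injEq,
        true_and] at h
      obtain ⟨h1, h2⟩ := he _ _ _ _ h
      obtain ⟨h3, h4⟩ := ih _ h2
      exact ⟨by rw [h1, h3], h4⟩

/-- Distinct inputs have distinct codes. -/
theorem Instance.encode_injective : Function.Injective Instance.encode := by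
  rintro ⟨m, l, R, S, α, k, p, hk, hkm, hp⟩ ⟨m', l', R', S', α', k', p', hk', hkm', hp'⟩ h
  simp only [Instance.encode, List.append_assoc] at h
  obtain ⟨hl, h1⟩ := encNat_append_inj h
  subst hl
  obtain ⟨hkk, h2⟩ := encNat_append_inj h1
  obtain ⟨hpp, h3⟩ := encNat_append_inj h2
  subst hkk hpp
  have hc : ∀ (n : ℕ) (f : Fin n → Finset (Fin l)) (g : Fin n → ℤ),
      ((List.finRange n).flatMap (fun c => encCandidate (f c) (g c))).head? ≠ some Sym.imp := by
    intro n f g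
    cases n <;> simp [List.finRange_succ, encCandidate]
  have hi : ∀ (z : ℤ) (s : List Sym), (encInt z ++ s).head? ≠ some Sym.attr := by
    intro z s
    simp only [encInt]
    split_ifs <;> simp
  obtain ⟨hR, h4⟩ := flatMap_append_inj (t := Sym.imp)
    (e := fun r : Constraint (Fin l) => encFormula r.lhs ++ encFormula r.rhs) (by
      rintro ⟨a, b⟩ ⟨c, d⟩ s s' g
      simp only [List.append_assoc] at g
      obtain ⟨e1, g1⟩ := encFormula_append_inj _ g
      obtain ⟨e2, g2⟩ := encFormula_append_inj _ g1
      exact ⟨by rw [e1, e2], g2⟩) (hc _ _ _) (hc _ _ _) R R' h3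
  subst hR
  have h5 := flatMap_append_inj (t := Sym.cand) (s := []) (s' := [])
    (e := fun c : Finset (Fin l) × ℤ =>
      (c.1.sort).flatMap (fun a : Fin l => Sym.attr :: encNat a) ++ encInt c.2) (by
      rintro ⟨a, b⟩ ⟨c, d⟩ s s' g
      simp only [List.append_assoc] at g
      obtain ⟨e1, g1⟩ := flatMap_append_inj (t := Sym.attr) (e := fun a : Fin l => encNat a)
        (by
          intro x y s s' g
          obtain ⟨g1, g2⟩ := encNat_append_inj g
          exact ⟨Fin.ext g1, g2⟩)
        (hi b s) (hi d s') _ _ g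
      obtain ⟨e2, g2⟩ := encInt_append_inj g1
      refine ⟨Prod.ext ?_ e2, g2⟩
      change a = c
      rw [← Finset.sort_toFinset a (· ≤ ·), e1, Finset.sort_toFinset]) (by simp) (by simp)
    ((List.finRange m).map (fun c => (α c, S c))) ((List.finRange m').map (fun c => (α' c, S' c)))
    (by simpa [List.flatMap_map, encCandidate] using h4)
  have h6 := h5.1
  have hm : m = m' := by simpa using congrArg List.length h6
  subst hm
  have h7 : ∀ c, α c = α' c ∧ S c = S' c := by
    intro c
    simpa using List.map_inj_left.1 h6 c (List.mem_finRange c)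
  obtain rfl : α = α' := funext fun c => (h7 c).1
  obtain rfl : S = S' := funext fun c => (h7 c).2
  rfl

/-! ### Solvability in polynomial time -/

open Classical in
/-- The decision problem `Q`, with inputs `x : β` given as the words `enc x`, is solvable in
polynomial time on the inputs with `P x`: some Turing machine that is started on `enc x`, for any
`x` with `P x`, halts with the correct answer to `Q x` after a number of steps that is bounded by a
polynomial in the length of `enc x`. -/
def SolvableInPolyTime {β Γ : Type} (enc : β → List Γ) (P Q : β → Prop) : Prop :=
  Nonempty (Turing.TM2ComputableInPolyTime
    (fun x : {x : β // P x} => enc x.1) Computability.encodeBool (fun x => decide (Q x.1)))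

end CECAC

/-! A candidate has at most one attribute, so the owner sets of different attributes are disjoint
(`disjoint_owners`). An attribute occurs at most once, so different subformulas involve different
attributes. Hence a committee splits into independent parts, one for each occurring attribute and
one for the remaining candidates, and dynamic programming along the formula trees succeeds.

For each subformula two tables are kept, one for making it true and one for making it false. Entry
`j` is the best profit of `j` owners of its attributes. Tables are polynomials over the max-plus
semiring, and independent parts multiply (`Rep.mul`). At a literal, the product of the factors 1 +
sX over the owners covers all subsets. The attribute is false only for the empty one
(`repPair_leaf`). A conjunction needs products and maxima (`RepPair.conTab`), and the other
connectives reduce to it by negation. At the end the table of all constraints is multiplied with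
that of the unconstrained candidates, and entry `k` is compared with `p` (`answer_run_encode`).
Table lengths add under products and each product costs one more digit, so sizes stay polynomial
(`St.Bdd.step`).

Read backwards, Polish notation delivers the operands before their connective, so the algorithm is
one fold over the reversed word with a stack of table pairs. To put it on a Turing machine,
structured programs on four bit stacks are compiled step for step (`Runs.reach`). Data are coded as
binary trees, and the class `PT` of polynomial-time functions is closed under composition, pairing,
case distinction and folds whose intermediate results stay polynomially bounded (`PT.foldl_of_le`).
A small wrapper handles input and output (`solvableInPolyTime_of_pt`). -/

namespace CECAC

/-! ### Structured programs on four stacks of bits -/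

/-- The work stacks. -/
inductive Reg : Type
  | m
  | a
  | b
  | c
  deriving DecidableEq

instance : Fintype Reg := ⟨{.m, .a, .b, .c}, fun x => by cases x <;> simp⟩

/-- The contents of the work stacks. -/
structure Store : Type where
  m : List Bool
  a : List Bool
  b : List Bool
  c : List Bool

namespace Store

/-- The contents of a stack. -/
def get (s : Store) : Reg → List Bool
  | .m => s.m
  | .a => s.a
  | .b => s.b
  | .c => s.c

/-- Overwrite a stack. -/
def set (s : Store) (k : Reg) (x : List Bool) : Store :=
  match k with
  | .m => { s with m := x }
  | .a => { s with a := x }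
  | .b => { s with b := x }
  | .c => { s with c := x }

/-- The total number of bits in the stacks. -/
def total (s : Store) : ℕ := s.m.length + s.a.length + s.b.length + s.c.length

theorem get_set (s : Store) (k : Reg) (x : List Bool) :
    (s.set k x).get = Function.update s.get k x := by
  funext k'
  cases k <;> cases k' <;> rfl

theorem total_set (s : Store) (k : Reg) (x : List Bool) :
    (s.set k x).total + (s.get k).length = s.total + x.length := by
  cases k <;> simp only [set, get, total] <;> omega

end Store

/-- Structured programs. `case` and `loop` pop a bit and continue with the program chosen by it;
`loop` does so repeatedly, until `halts` holds of what was popped. -/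
inductive Prog : Type
  | skip
  | push (k : Reg) (x : Bool)
  | seq (p q : Prog)
  | case (k : Reg) (f : Option Bool → Prog)
  | loop (k : Reg) (halts : Option Bool → Bool) (f : Option Bool → Prog)

/-- `Runs p s s' t`: the program `p`, started with the stacks `s`, ends with the stacks `s'` after
`t` steps. -/
inductive Runs : Prog → Store → Store → ℕ → Prop
  | skip (s : Store) : Runs .skip s s 1
  | push (k : Reg) (x : Bool) (s : Store) : Runs (.push k x) s (s.set k (x :: s.get k)) 1
  | seq {p q : Prog} {s s' s'' : Store} {t t' : ℕ} :
      Runs p s s' t → Runs q s' s'' t' → Runs (.seq p q) s s'' (t + t')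
  | case {k : Reg} {f : Option Bool → Prog} {s s' : Store} {t : ℕ} :
      Runs (f (s.get k).head?) (s.set k (s.get k).tail) s' t → Runs (.case k f) s s' (1 + t)
  | quit {k : Reg} {halts : Option Bool → Bool} {f : Option Bool → Prog} {s : Store} :
      halts (s.get k).head? = true → Runs (.loop k halts f) s (s.set k (s.get k).tail) 1
  | iter {k : Reg} {halts : Option Bool → Bool} {f : Option Bool → Prog} {s s' s'' : Store}
      {t t' : ℕ} : halts (s.get k).head? = false →
      Runs (f (s.get k).head?) (s.set k (s.get k).tail) s' t →
      Runs (.loop k halts f) s' s'' t' → Runs (.loop k halts f) s s'' (1 + t + t')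

/-- A step pushes at most one bit. This turns time bounds into size bounds for results, which
composition needs. -/
theorem Runs.total_le {p : Prog} {s s' : Store} {t : ℕ} (h : Runs p s s' t) :
    s'.total ≤ s.total + t := by
  induction h with
  | skip s => omega
  | push k x s =>
    have := s.total_set k (x :: s.get k)
    simp only [List.length_cons] at this
    omega
  | seq _ _ ih ih' => omega
  | @case k f s s' t _ ih =>
    have := s.total_set k (s.get k).tail
    simp only [List.length_tail] at this
    omega
  | @quit k halts f s _ =>
    have := s.total_set k (s.get k).tail
    simp only [List.length_tail] at this
    omega
  | @iter k halts f s s' s'' t t' _ _ _ ih ih' =>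
    have := s.total_set k (s.get k).tail
    simp only [List.length_tail] at this
    omega

/-! ### Compilation of structured programs to multi-stack Turing machines -/

/-- The labels of the compiled program. -/
def Prog.Lab : Prog → Type
  | .skip => Unit
  | .push _ _ => Unit
  | .seq p q => p.Lab ⊕ q.Lab
  | .case _ f => Option (Σ o, (f o).Lab)
  | .loop _ _ f => Option (Σ o, (f o).Lab)

/-- There are finitely many labels. -/
@[reducible]
def Prog.fintypeLab : (p : Prog) → Fintype p.Lab
  | .skip => inferInstanceAs (Fintype Unit)
  | .push _ _ => inferInstanceAs (Fintype Unit)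
  | .seq p q =>
    haveI := p.fintypeLab
    haveI := q.fintypeLab
    inferInstanceAs (Fintype (p.Lab ⊕ q.Lab))
  | .case _ f =>
    haveI := fun o => (f o).fintypeLab
    inferInstanceAs (Fintype (Option (Σ o, (f o).Lab)))
  | .loop _ _ f =>
    haveI := fun o => (f o).fintypeLab
    inferInstanceAs (Fintype (Option (Σ o, (f o).Lab)))

instance (p : Prog) : Fintype p.Lab := p.fintypeLab

/-- The entry label. -/
def Prog.start : (p : Prog) → p.Lab
  | .skip => ()
  | .push _ _ => ()
  | .seq p _ => Sum.inl p.start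
  | .case _ _ => none
  | .loop _ _ _ => none

/-- The stack alphabets: the stack `none` holds the input. -/
abbrev Alph : Option Reg → Type
  | none => Sym
  | some _ => Bool

/-- The stack contents given by the unread input and the work stacks. -/
def contents (w : List Sym) (s : Store) : (k : Option Reg) → List (Alph k)
  | none => w
  | some k => s.get k

theorem contents_update (w : List Sym) (s : Store) (k : Reg) (x : List Bool) :
    Function.update (contents w s) (some k) x = contents w (s.set k x) := by
  funext k'
  rcases k' with _ | k'
  · rw [Function.update_of_ne (by simp)]
    rfl
  · rcases eq_or_ne k' k with rfl | h
    · rw [Function.update_self]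
      simp [contents, Store.get_set]
    · rw [Function.update_of_ne (by simpa using h)]
      simp [contents, Store.get_set, h]

/-- The bit held by the internal state. -/
def bitOf : Option Sym → Option Bool
  | some (Sym.bit x) => some x
  | _ => none

theorem bitOf_map (o : Option Bool) : bitOf (o.map Sym.bit) = o := by
  cases o <;> rfl

open Turing

/-- Pop a bit and jump to a label chosen by it. -/
def popGoto {Λ : Type} (k : Reg) (g : Option Bool → Λ) : TM2.Stmt Alph Λ (Option Sym) :=
  .pop (some k) (fun _ o => Option.map Sym.bit o) (.goto fun v => g (bitOf v))

theorem stepAux_popGoto {Λ : Type} (k : Reg) (g : Option Bool → Λ) (w : List Sym) (v : Option Sym)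
    (s : Store) : TM2.stepAux (popGoto k g) v (contents w s) =
      ⟨some (g (s.get k).head?), (s.get k).head?.map Sym.bit,
        contents w (s.set k (s.get k).tail)⟩ := by
  rw [← contents_update]
  simp only [popGoto, TM2.stepAux]
  congr 2
  exact congrArg g (bitOf_map _)

/-- The compiled program, with labels in a larger set and an exit label. -/
def Prog.compile {Λ : Type} : (p : Prog) → (p.Lab → Λ) → Λ → p.Lab → TM2.Stmt Alph Λ (Option Sym)
  | .skip, _, x, _ => .goto fun _ => x
  | .push k y, _, x, _ => .push (some k) (fun _ => y) (.goto fun _ => x)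
  | .seq p q, e, x, l =>
    match l with
    | Sum.inl l => p.compile (fun l => e (Sum.inl l)) (e (Sum.inr q.start)) l
    | Sum.inr l => q.compile (fun l => e (Sum.inr l)) x l
  | .case k f, e, x, l =>
    match l with
    | none => popGoto k fun o => e (some ⟨o, (f o).start⟩)
    | some ⟨o, l⟩ => (f o).compile (fun l => e (some ⟨o, l⟩)) x l
  | .loop k halts f, e, x, l =>
    match l with
    | none => popGoto k fun o => if halts o then x else e (some ⟨o, (f o).start⟩)
    | some ⟨o, l⟩ => (f o).compile (fun l => e (some ⟨o, l⟩)) (e none) l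

/-- The machine `M` gets from `c` to `c'` in `t` steps. -/
def Reach {Λ : Type} (M : Λ → TM2.Stmt Alph Λ (Option Sym)) (t : ℕ)
    (c c' : TM2.Cfg Alph Λ (Option Sym)) : Prop :=
  (flip bind (TM2.step M))^[t] (some c) = some c'

section

variable {Λ : Type} {M : Λ → TM2.Stmt Alph Λ (Option Sym)}

theorem Reach.trans {t t' : ℕ} {c c' c'' : TM2.Cfg Alph Λ (Option Sym)}
    (h : Reach M t c c') (h' : Reach M t' c' c'') : Reach M (t + t') c c'' := by
  unfold Reach at *
  rw [Nat.add_comm, Function.iterate_add_apply, h, h']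

theorem Reach.single {l : Λ} {v : Option Sym} {S : ∀ k, List (Alph k)}
    {c : TM2.Cfg Alph Λ (Option Sym)} (h : TM2.stepAux (M l) v S = c) :
    Reach M 1 ⟨some l, v, S⟩ c := by
  subst h
  rfl

/-- Each step of a structured program is exactly one machine step. The embedding `e` and the exit
`x` are arbitrary because a subprogram sits inside a larger label set and exits to its continuation.
The internal state is irrelevant on entry, since every pop overwrites it before it is consulted. -/
theorem Runs.reach {p : Prog} {s s' : Store} {t : ℕ} (h : Runs p s s' t) :
    ∀ (e : p.Lab → Λ) (x : Λ), (∀ l, M (e l) = p.compile e x l) → ∀ (w : List Sym) (v : Option Sym),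
      ∃ v', Reach M t ⟨some (e p.start), v, contents w s⟩ ⟨some x, v', contents w s'⟩ := by
  induction h with
  | skip s =>
    intro e x hM w v
    refine ⟨v, Reach.single ?_⟩
    rw [hM]
    rfl
  | push k y s =>
    intro e x hM w v
    refine ⟨v, Reach.single ?_⟩
    rw [hM]
    simp only [Prog.compile, TM2.stepAux]
    exact congrArg _ (contents_update w s k _)
  | @seq p q s s' s'' t t' _ _ ih ih' =>
    intro e x hM w v
    obtain ⟨v', h1⟩ := ih (fun l => e (Sum.inl l)) (e (Sum.inr q.start)) (fun l => hM _) w v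
    obtain ⟨v'', h2⟩ := ih' (fun l => e (Sum.inr l)) x (fun l => hM _) w v'
    exact ⟨v'', h1.trans h2⟩
  | @case k f s s' t _ ih =>
    intro e x hM w v
    obtain ⟨v', h1⟩ := ih (fun l => e (some ⟨_, l⟩)) x (fun l => hM _) w
      (Option.map Sym.bit (s.get k).head?)
    refine ⟨v', (Reach.single ?_).trans h1⟩
    rw [hM]
    exact (stepAux_popGoto k _ w v s).trans (by rfl)
  | @quit k halts f s hs =>
    intro e x hM w v
    refine ⟨Option.map Sym.bit (s.get k).head?, Reach.single ?_⟩
    rw [hM]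
    exact (stepAux_popGoto k _ w v s).trans (by rw [hs]; rfl)
  | @iter k halts f s s' s'' t t' hs _ _ ih ih' =>
    intro e x hM w v
    -- The body of a loop exits to the entry label of the loop.
    obtain ⟨v', h1⟩ := ih (fun l => e (some ⟨_, l⟩)) (e none) (fun l => hM _) w
      (Option.map Sym.bit (s.get k).head?)
    obtain ⟨v'', h2⟩ := ih' e x hM w v'
    refine ⟨v'', ((Reach.single ?_).trans h1).trans h2⟩
    rw [hM]
    exact (stepAux_popGoto k _ w v s).trans (by rw [hs]; rfl)

end

/-! ### Binary trees as data -/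

/-- Binary trees. -/
inductive Tree : Type
  | nil
  | cons (x y : Tree)
  deriving DecidableEq

namespace Tree

/-- The code of a tree in Polish notation. -/
def code : Tree → List Bool
  | nil => [false]
  | cons x y => true :: (x.code ++ y.code)

/-- The length of the code. -/
def size (x : Tree) : ℕ := x.code.length

@[simp] theorem size_nil : nil.size = 1 := rfl

@[simp] theorem size_cons (x y : Tree) : (cons x y).size = x.size + y.size + 1 := by
  simp [size, code]

/-- The left subtree. -/
def left : Tree → Tree
  | nil => nil
  | cons x _ => x

/-- The right subtree. -/
def right : Tree → Tree
  | nil => nil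
  | cons _ y => y

end Tree

/-! ### Basic programs on the code of a tree on top of the main stack -/

namespace Prog

/-- Move a stack onto another one. -/
def move (k k' : Reg) : Prog := .loop k (fun o => o.isNone) fun o => .push k' (o.getD false)

/-- Move the tree on top of the main stack to the stack `k`, reversed. -/
def scan (k : Reg) : Prog :=
  .seq (.push .c true) <| .loop .c (fun o => o.isNone) fun _ => .case .m fun o =>
    if o = some true then .seq (.push k true) (.seq (.push .c true) (.push .c true))
    else .push k false

/-- Delete the tree on top of the main stack. -/
def drop : Prog := .seq (scan .a) (.loop .a (fun o => o.isNone) fun _ => .skip)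

/-- Exchange the two trees on top of the main stack. -/
def swap : Prog := .seq (scan .a) (.seq (scan .b) (.seq (move .a .m) (move .b .m)))

/-- Double the tree on top of the main stack. -/
def dup : Prog :=
  .seq (scan .a) <| .seq (.loop .a (fun o => o.isNone) fun o =>
    .seq (.push .m (o.getD false)) (.push .b (o.getD false))) <| .seq (move .b .a) (move .a .m)

/-- Replace the tree on top of the main stack by its left subtree. -/
def left : Prog := .case .m fun o =>
  if o = some true then .seq (scan .a) (.seq drop' (move .a .m)) else .push .m false
where
  /-- Delete a tree without use of the stack `a`. -/
  drop' : Prog := .seq (scan .b) (.loop .b (fun o => o.isNone) fun _ => .skip)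

/-- Replace the tree on top of the main stack by its right subtree. -/
def right : Prog := .case .m fun o => if o = some true then drop else .push .m false

end Prog

/-- There is a run within a time bound. -/
def RunsIn (p : Prog) (s s' : Store) (t : ℕ) : Prop := ∃ t' ≤ t, Runs p s s' t'

theorem RunsIn.mono {p : Prog} {s s' : Store} {t t' : ℕ} (h : RunsIn p s s' t) (ht : t ≤ t') :
    RunsIn p s s' t' := by
  obtain ⟨u, hu, h⟩ := h
  exact ⟨u, hu.trans ht, h⟩

theorem RunsIn.seq {p q : Prog} {s s' s'' : Store} {t t' : ℕ} (h : RunsIn p s s' t)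
    (h' : RunsIn q s' s'' t') : RunsIn (.seq p q) s s'' (t + t') := by
  obtain ⟨u, hu, h⟩ := h
  obtain ⟨u', hu', h'⟩ := h'
  exact ⟨u + u', by omega, h.seq h'⟩

theorem RunsIn.case {k : Reg} {f : Option Bool → Prog} {s s' : Store} {t : ℕ}
    (h : RunsIn (f (s.get k).head?) (s.set k (s.get k).tail) s' t) :
    RunsIn (.case k f) s s' (1 + t) := by
  obtain ⟨u, hu, h⟩ := h
  exact ⟨1 + u, by omega, h.case⟩

theorem RunsIn.iter {k : Reg} {halts : Option Bool → Bool} {f : Option Bool → Prog}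
    {s s' s'' : Store} {t t' : ℕ} (hs : halts (s.get k).head? = false)
    (h : RunsIn (f (s.get k).head?) (s.set k (s.get k).tail) s' t)
    (h' : RunsIn (.loop k halts f) s' s'' t') : RunsIn (.loop k halts f) s s'' (1 + t + t') := by
  obtain ⟨u, hu, h⟩ := h
  obtain ⟨u', hu', h'⟩ := h'
  exact ⟨1 + u + u', by omega, .iter hs h h'⟩

theorem Runs.runsIn {p : Prog} {s s' : Store} {t : ℕ} (h : Runs p s s' t) : RunsIn p s s' t :=
  ⟨t, le_rfl, h⟩

theorem runsIn_push (k : Reg) (x : Bool) (s : Store) :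
    RunsIn (.push k x) s (s.set k (x :: s.get k)) 1 := (Runs.push k x s).runsIn

theorem runsIn_quit {k : Reg} {halts : Option Bool → Bool} {f : Option Bool → Prog} {s : Store}
    (hs : halts (s.get k).head? = true) :
    RunsIn (.loop k halts f) s (s.set k (s.get k).tail) 1 := (Runs.quit hs).runsIn

/-! ### Running times of the basic stack operations -/

theorem runsIn_move_a_m (x m b c : List Bool) :
    RunsIn (.move .a .m) ⟨m, x, b, c⟩ ⟨x.reverse ++ m, [], b, c⟩ (2 * x.length + 1) := by
  induction x generalizing m with
  | nil => exact runsIn_quit (s := ⟨m, [], b, c⟩) rfl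
  | cons y x ih =>
    rw [List.reverse_cons, List.append_assoc]
    refine (RunsIn.iter (s := ⟨m, y :: x, b, c⟩) rfl (runsIn_push _ _ _) (ih (y :: m))).mono ?_
    simp only [List.length_cons]
    omega

theorem runsIn_move_b_m (x m a c : List Bool) :
    RunsIn (.move .b .m) ⟨m, a, x, c⟩ ⟨x.reverse ++ m, a, [], c⟩ (2 * x.length + 1) := by
  induction x generalizing m with
  | nil => exact runsIn_quit (s := ⟨m, a, [], c⟩) rfl
  | cons y x ih =>
    rw [List.reverse_cons, List.append_assoc]
    refine (RunsIn.iter (s := ⟨m, a, y :: x, c⟩) rfl (runsIn_push _ _ _) (ih (y :: m))).mono ?_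
    simp only [List.length_cons]
    omega

theorem runsIn_move_b_a (x m a c : List Bool) :
    RunsIn (.move .b .a) ⟨m, a, x, c⟩ ⟨m, x.reverse ++ a, [], c⟩ (2 * x.length + 1) := by
  induction x generalizing a with
  | nil => exact runsIn_quit (s := ⟨m, a, [], c⟩) rfl
  | cons y x ih =>
    rw [List.reverse_cons, List.append_assoc]
    refine (RunsIn.iter (s := ⟨m, a, y :: x, c⟩) rfl (runsIn_push _ _ _) (ih (y :: a))).mono ?_
    simp only [List.length_cons]
    omega

theorem runsIn_clear_a (x m b c : List Bool) :
    RunsIn (.loop .a (fun o => o.isNone) fun _ => .skip) ⟨m, x, b, c⟩ ⟨m, [], b, c⟩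
      (2 * x.length + 1) := by
  induction x with
  | nil => exact runsIn_quit (s := ⟨m, [], b, c⟩) rfl
  | cons y x ih =>
    refine (RunsIn.iter (s := ⟨m, y :: x, b, c⟩) rfl (Runs.skip _).runsIn ih).mono ?_
    simp only [List.length_cons]
    omega

theorem runsIn_clear_b (x m a c : List Bool) :
    RunsIn (.loop .b (fun o => o.isNone) fun _ => .skip) ⟨m, a, x, c⟩ ⟨m, a, [], c⟩
      (2 * x.length + 1) := by
  induction x with
  | nil => exact runsIn_quit (s := ⟨m, a, [], c⟩) rfl
  | cons y x ih =>
    refine (RunsIn.iter (s := ⟨m, a, y :: x, c⟩) rfl (Runs.skip _).runsIn ih).mono ?_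
    simp only [List.length_cons]
    omega

/-- The stacks with `x` put in front of the stack `k`, for one tree less to be scanned. -/
theorem runsIn_scan_loop {k : Reg} (hk : k = .a ∨ k = .b) (x : Tree) :
    ∀ (s s' : Store) (r c : List Bool) (t : ℕ), s.m = x.code ++ r → s.c = true :: c →
      RunsIn (.loop .c (fun o => o.isNone) fun _ => .case .m fun o =>
        if o = some true then .seq (.push k true) (.seq (.push .c true) (.push .c true))
        else .push k false)
        (((s.set .m r).set .c c).set k (x.code.reverse ++ s.get k)) s' t →
      RunsIn (.loop .c (fun o => o.isNone) fun _ => .case .m fun o =>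
        if o = some true then .seq (.push k true) (.seq (.push .c true) (.push .c true))
        else .push k false) s s' (6 * x.size + t) := by
  induction x with
  | nil =>
    rintro ⟨m, a, b, c'⟩ s' r c t rfl rfl h
    -- The stack `c` is a unary counter of the trees still to be scanned. A leaf uses up one token.
    refine (RunsIn.iter rfl (RunsIn.case (runsIn_push _ _ _)) ?_).mono
      (show 1 + (1 + 1) + t ≤ _ by simp)
    rcases hk with rfl | rfl <;> exact h
  | cons x y ihx ihy =>
    rintro ⟨m, a, b, c'⟩ s' r c t rfl rfl h
    -- A node trades its token for two, one for each child, at a cost of five steps. The induction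
    -- hypotheses then scan the children in turn.
    refine (RunsIn.iter rfl (RunsIn.case ((runsIn_push _ _ _).seq
      ((runsIn_push _ _ _).seq (runsIn_push _ _ _)))) ?_).mono
      (show 1 + (1 + (1 + (1 + 1))) + (6 * x.size + (6 * y.size + t)) ≤ _ by simp; omega)
    rcases hk with rfl | rfl
    · refine ihx _ _ (y.code ++ r) (true :: c) _ (by simp [Store.set, Store.get, Tree.code]) rfl
        (ihy _ _ r c _ rfl rfl ?_)
      simpa [Store.set, Store.get, Tree.code] using h
    · refine ihx _ _ (y.code ++ r) (true :: c) _ (by simp [Store.set, Store.get, Tree.code]) rfl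
        (ihy _ _ r c _ rfl rfl ?_)
      simpa [Store.set, Store.get, Tree.code] using h

theorem runsIn_scan_a (x : Tree) (r a b : List Bool) :
    RunsIn (.scan .a) ⟨x.code ++ r, a, b, []⟩ ⟨r, x.code.reverse ++ a, b, []⟩ (6 * x.size + 2) := by
  refine ((runsIn_push _ _ _).seq (runsIn_scan_loop (Or.inl rfl) x _ _ r [] 1 rfl rfl
    (runsIn_quit rfl))).mono (by omega)

theorem runsIn_scan_b (x : Tree) (r a b : List Bool) :
    RunsIn (.scan .b) ⟨x.code ++ r, a, b, []⟩ ⟨r, a, x.code.reverse ++ b, []⟩ (6 * x.size + 2) := by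
  refine ((runsIn_push _ _ _).seq (runsIn_scan_loop (Or.inr rfl) x _ _ r [] 1 rfl rfl
    (runsIn_quit rfl))).mono (by omega)

theorem runsIn_drop (x : Tree) (r : List Bool) :
    RunsIn .drop ⟨x.code ++ r, [], [], []⟩ ⟨r, [], [], []⟩ (8 * x.size + 3) := by
  refine ((runsIn_scan_a x r [] []).seq (runsIn_clear_a _ _ _ _)).mono ?_
  simp [Tree.size]
  omega

/-- The two trees wait reversed on `a` and `b`. The one on `a` is moved back first and therefore
ends up below. -/
theorem runsIn_swap (x y : Tree) (r : List Bool) :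
    RunsIn .swap ⟨x.code ++ (y.code ++ r), [], [], []⟩ ⟨y.code ++ (x.code ++ r), [], [], []⟩
      (8 * x.size + 8 * y.size + 6) := by
  have h1 := runsIn_scan_a x (y.code ++ r) [] []
  have h2 := runsIn_scan_b y r (x.code.reverse ++ []) []
  have h3 := runsIn_move_a_m (x.code.reverse ++ []) r (y.code.reverse ++ []) []
  have h4 := runsIn_move_b_m (y.code.reverse ++ []) (x.code ++ r) [] []
  simp only [List.append_nil, List.reverse_reverse, List.length_reverse] at h1 h2 h3 h4
  refine (h1.seq (h2.seq (h3.seq h4))).mono ?_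
  simp only [Tree.size]
  omega

theorem runsIn_dup (x : Tree) (r : List Bool) :
    RunsIn .dup ⟨x.code ++ r, [], [], []⟩ ⟨x.code ++ (x.code ++ r), [], [], []⟩
      (13 * x.size + 5) := by
  have key : ∀ (y m b : List Bool), RunsIn (.loop .a (fun o => o.isNone) fun o =>
      .seq (.push .m (o.getD false)) (.push .b (o.getD false))) ⟨m, y, b, []⟩
      ⟨y.reverse ++ m, [], y.reverse ++ b, []⟩ (3 * y.length + 1) := by
    intro y
    induction y with
    | nil => exact fun m b => runsIn_quit (s := ⟨m, [], b, []⟩) rfl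
    | cons z y ih =>
      intro m b
      rw [List.reverse_cons, List.append_assoc, List.append_assoc]
      refine (RunsIn.iter (s := ⟨m, z :: y, b, []⟩) rfl
        ((runsIn_push _ _ _).seq (runsIn_push _ _ _)) (ih (z :: m) (z :: b))).mono ?_
      simp only [List.length_cons]
      omega
  have h1 := runsIn_scan_a x r [] []
  have h2 := key (x.code.reverse ++ []) r []
  have h3 := runsIn_move_b_a (x.code ++ []) (x.code ++ r) [] []
  have h4 := runsIn_move_a_m (x.code.reverse ++ []) (x.code ++ r) [] []
  simp only [List.append_nil, List.reverse_reverse, List.length_reverse] at h1 h2 h3 h4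
  refine (h1.seq (h2.seq (h3.seq h4))).mono ?_
  simp only [Tree.size]
  omega

/-- The left subtree waits on `a` while the right one is deleted, so the deletion has to work with
`b`. -/
theorem runsIn_left (x : Tree) (r : List Bool) :
    RunsIn .left ⟨x.code ++ r, [], [], []⟩ ⟨x.left.code ++ r, [], [], []⟩ (8 * x.size + 7) := by
  cases x with
  | nil => exact (RunsIn.case (runsIn_push _ _ _)).mono (by simp)
  | cons x y =>
    have h1 := runsIn_scan_a x (y.code ++ r) [] []
    have h2 := runsIn_scan_b y r (x.code.reverse ++ []) []
    have h3 := runsIn_clear_b (y.code.reverse ++ []) r (x.code.reverse ++ []) []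
    have h4 := runsIn_move_a_m (x.code.reverse ++ []) r [] []
    simp only [List.append_nil, List.reverse_reverse, List.length_reverse] at h1 h2 h3 h4
    refine (RunsIn.case (s := ⟨(Tree.cons x y).code ++ r, [], [], []⟩) ?_).mono
      (show 1 + (8 * (x.size + y.size) + 6) ≤ _ by simp; omega)
    simp only [Tree.code, List.cons_append, List.append_assoc]
    refine (h1.seq ((h2.seq h3).seq h4)).mono ?_
    simp only [Tree.size]
    omega

theorem runsIn_right (x : Tree) (r : List Bool) :
    RunsIn .right ⟨x.code ++ r, [], [], []⟩ ⟨x.right.code ++ r, [], [], []⟩ (8 * x.size + 7) := by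
  cases x with
  | nil => exact (RunsIn.case (runsIn_push _ _ _)).mono (by simp)
  | cons x y =>
    refine (RunsIn.case (s := ⟨(Tree.cons x y).code ++ r, [], [], []⟩)
      (t := 8 * x.size + 3) ?_).mono (by simp; omega)
    simp only [Tree.code, List.cons_append, List.append_assoc]
    exact runsIn_drop x (y.code ++ r)

/-! ### Functions computable in polynomial time on encoded data -/

/-- Types whose elements are encoded as trees. -/
class Enc (α : Type) where
  /-- the code of an element -/
  enc : α → Tree

open Enc (enc)

instance : Enc Tree := ⟨id⟩

instance : Enc Unit := ⟨fun _ => .nil⟩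

instance : Enc Bool := ⟨fun b => cond b (.cons .nil .nil) .nil⟩

instance {α β : Type} [Enc α] [Enc β] : Enc (α × β) := ⟨fun x => .cons (enc x.1) (enc x.2)⟩

instance {α : Type} [Enc α] : Enc (List α) := ⟨List.foldr (fun a t => .cons (enc a) t) .nil⟩

instance {α : Type} [Enc α] : Enc (Option α) :=
  ⟨fun o => match o with
    | none => .nil
    | some a => .cons (enc a) .nil⟩

instance {α : Type} [Enc α] (p : α → Prop) : Enc {x // p x} := ⟨fun x => enc x.1⟩

/-- The size of the code of an element. -/
def esize {α : Type} [Enc α] (a : α) : ℕ := (enc a).size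

/-! ### Sizes of codes -/

section Size

variable {α β : Type} [Enc α] [Enc β]

theorem code_prod_append (a : α) (b : β) (r : List Bool) :
    (enc (a, b)).code ++ r = true :: ((enc a).code ++ ((enc b).code ++ r)) := by
  simp [enc, Tree.code]

theorem code_cons_append (a : α) (l : List α) (r : List Bool) :
    (enc (a :: l)).code ++ r = true :: ((enc a).code ++ ((enc l).code ++ r)) := by
  simp [enc, Tree.code]

theorem one_le_esize (a : α) : 1 ≤ esize a := by
  unfold esize
  cases enc a <;> simp

theorem esize_prod (a : α) (b : β) : esize (a, b) = esize a + esize b + 1 :=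
  Tree.size_cons _ _

theorem esize_nil : esize ([] : List α) = 1 := rfl

theorem esize_cons (a : α) (l : List α) : esize (a :: l) = esize a + esize l + 1 :=
  Tree.size_cons _ _

theorem esize_none : esize (none : Option α) = 1 := rfl

theorem esize_some (a : α) : esize (some a) = esize a + 2 :=
  Tree.size_cons _ _

theorem esize_bool_le (b : Bool) : esize b ≤ 3 := by
  cases b <;> decide

theorem esize_append (l l' : List α) : esize (l ++ l') + 1 = esize l + esize l' := by
  induction l with
  | nil => simp [esize_nil]; omega
  | cons a l ih => simp only [List.cons_append, esize_cons]; omega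

theorem esize_le_of_mem {a : α} {l : List α} (h : a ∈ l) : esize a ≤ esize l := by
  induction l with
  | nil => simp at h
  | cons b l ih =>
    rw [esize_cons]
    rcases List.mem_cons.1 h with rfl | h
    · omega
    · have := ih h
      omega

theorem length_le_esize (l : List α) : l.length ≤ esize l := by
  induction l with
  | nil => simp
  | cons b l ih =>
    rw [esize_cons, List.length_cons]
    omega

end Size

theorem eval_mono (P : Polynomial ℕ) {m n : ℕ} (h : m ≤ n) : P.eval m ≤ P.eval n := by
  induction P using Polynomial.induction_on' with
  | add p q hp hq => simpa using add_le_add hp hq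
  | monomial k a => simpa using Nat.mul_le_mul_left a (Nat.pow_le_pow_left h k)

/-- `PT f`: some program turns the code of any `a` into the code of `f a` in polynomial time. -/
@[fun_prop]
def PT {α β : Type} [Enc α] [Enc β] (f : α → β) : Prop :=
  ∃ (p : Prog) (P : Polynomial ℕ), ∀ a r, RunsIn p ⟨(enc a).code ++ r, [], [], []⟩
    ⟨(enc (f a)).code ++ r, [], [], []⟩ (P.eval (esize a))

namespace PT

open Polynomial (X)

variable {α β γ δ : Type} [Enc α] [Enc β] [Enc γ] [Enc δ]

theorem esize_le {f : α → β} (hf : PT f) : ∃ P : Polynomial ℕ, ∀ a, esize (f a) ≤ P.eval (esize a) := by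
  obtain ⟨p, P, h⟩ := hf
  refine ⟨X + P, fun a => ?_⟩
  obtain ⟨t, ht, h⟩ := h a []
  have := h.total_le
  simp only [Store.total, List.append_nil, List.length_nil] at this
  simp only [Polynomial.eval_add, Polynomial.eval_X, esize, Tree.size] at *
  omega

/-- A program sees only codes. Repackaging that leaves the code unchanged (list cells as pairs,
subtypes, structures) is therefore free. -/
theorem of_enc {f : α → β} (hf : PT f) {g : α → γ} (h : ∀ a, enc (g a) = enc (f a)) : PT g := by
  obtain ⟨p, P, hp⟩ := hf
  exact ⟨p, P, fun a r => by rw [h]; exact hp a r⟩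

theorem of_eq {f g : α → β} (hf : PT f) (h : ∀ a, g a = f a) : PT g :=
  hf.of_enc fun a => by rw [h]

@[fun_prop]
protected theorem id : PT (fun a : α => a) :=
  ⟨.skip, 1, fun a r => by simpa using (Runs.skip _).runsIn⟩

theorem comp {g : β → γ} {f : α → β} (hg : PT g) (hf : PT f) : PT fun a => g (f a) := by
  obtain ⟨Q, hQ⟩ := hf.esize_le
  obtain ⟨q, P', hq⟩ := hg
  obtain ⟨p, P, hp⟩ := hf
  refine ⟨.seq p q, P + P'.comp Q, fun a r => ((hp a r).seq (hq (f a) r)).mono ?_⟩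
  simpa using eval_mono P' (hQ a)

attribute [fun_prop] comp

-- The code of a pair is `true`, then the first component, then the second. So the second is
-- computed first, on a copy of the argument; the argument is then brought to the top for the first,
-- and a final `true` joins them. The arbitrary stack content `r` in `PT` makes this possible.
@[fun_prop]
theorem prodMk {f : α → β} {g : α → γ} (hf : PT f) (hg : PT g) : PT fun a => (f a, g a) := by
  obtain ⟨Q, hQ⟩ := hg.esize_le
  obtain ⟨p, P, hp⟩ := hf
  obtain ⟨q, P', hq⟩ := hg
  refine ⟨.seq .dup (.seq q (.seq .swap (.seq p (.push .m true)))),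
    (13 * X + 5) + (P' + ((8 * Q + 8 * X + 6) + (P + 1))), fun a r => ?_⟩
  simp only [code_prod_append]
  refine ((runsIn_dup (enc a) r).seq ((hq a _).seq ((runsIn_swap _ _ r).seq
    ((hp a _).seq (runsIn_push _ _ _))))).mono ?_
  have := hQ a
  simp only [Polynomial.eval_add, Polynomial.eval_mul, Polynomial.eval_X, Polynomial.eval_ofNat,
    Polynomial.eval_one, esize] at *
  omega

theorem of_tree {F : Tree → Tree} (hF : PT F) {f : α → β} (h : ∀ a, enc (f a) = F (enc a)) : PT f :=
  (hF.comp (f := fun a : α => enc a) (PT.id.of_enc fun _ => rfl)).of_enc h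

theorem treeLeft : PT Tree.left :=
  ⟨.left, 8 * X + 7, fun a r => (runsIn_left a r).mono (by simp [esize, enc])⟩

theorem treeRight : PT Tree.right :=
  ⟨.right, 8 * X + 7, fun a r => (runsIn_right a r).mono (by simp [esize, enc])⟩

@[fun_prop]
theorem fst {f : α → β × γ} (hf : PT f) : PT fun a => (f a).1 :=
  (treeLeft.of_tree (f := fun x : β × γ => x.1) fun _ => rfl).comp hf

@[fun_prop]
theorem snd {f : α → β × γ} (hf : PT f) : PT fun a => (f a).2 :=
  (treeRight.of_tree (f := fun x : β × γ => x.2) fun _ => rfl).comp hf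

theorem const_tree (t : Tree) : PT fun _ : α => t := by
  induction t with
  | nil =>
    refine ⟨.seq .drop (.push .m false), 8 * X + 3 + 1, fun a r =>
      ((runsIn_drop (enc a) r).seq (runsIn_push _ _ _)).mono ?_⟩
    simp [esize]
  | cons x y hx hy => exact (hx.prodMk hy).of_enc fun _ => rfl

@[fun_prop]
theorem const (b : β) : PT fun _ : α => b := (const_tree (enc b)).of_enc fun _ => rfl

/-- Each branch has to work only on the subtype where it is taken, which admits partial operations
such as `List.head`. -/
theorem dite {c : α → Bool} {f : {a // c a = true} → β} {g : {a // c a = false} → β} (hc : PT c)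
    (hf : PT f) (hg : PT g) :
    PT fun a => if h : c a = true then f ⟨a, h⟩ else g ⟨a, by simpa using h⟩ := by
  obtain ⟨p, P, hp⟩ := hf
  obtain ⟨q, P', hq⟩ := hg
  obtain ⟨k, Q, hk⟩ := hc
  refine ⟨.seq .dup (.seq k (.case .m fun o =>
    -- The code of `true` has three bits, and the outer `case` has popped only the first.
    if o = some true then .case .m fun _ => .case .m fun _ => p else q)),
    (13 * X + 5) + (Q + (3 + P + P')), fun a r => ?_⟩
  have h2 := hk a ((enc a).code ++ r)
  rcases h : c a with _ | _
  · rw [h] at h2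
    have e : (if h : c a = true then f ⟨a, h⟩ else g ⟨a, by simpa using h⟩) = g ⟨a, h⟩ :=
      dif_neg (by simp [h])
    simp only [e]
    refine ((runsIn_dup (enc a) r).seq (h2.seq (RunsIn.case (hq ⟨a, h⟩ r)))).mono ?_
    simp [esize, enc]
    omega
  · rw [h] at h2
    have e : (if h : c a = true then f ⟨a, h⟩ else g ⟨a, by simpa using h⟩) = f ⟨a, h⟩ :=
      dif_pos h
    simp only [e]
    refine ((runsIn_dup (enc a) r).seq (h2.seq (RunsIn.case
      (RunsIn.case (RunsIn.case (hp ⟨a, h⟩ r)))))).mono ?_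
    simp [esize, enc]
    omega

theorem subtype_val {p : α → Prop} : PT fun a : {a // p a} => a.1 := PT.id.of_enc fun _ => rfl

theorem ite_bool {c : α → Bool} {f g : α → β} (hc : PT c) (hf : PT f) (hg : PT g) :
    PT fun a => if c a = true then f a else g a :=
  (dite hc (hf.comp subtype_val) (hg.comp subtype_val)).of_eq fun a => by
    by_cases h : c a = true <;> simp [h]

@[fun_prop]
theorem cond {c : α → Bool} {f g : α → β} (hc : PT c) (hf : PT f) (hg : PT g) :
    PT fun a => cond (c a) (f a) (g a) :=
  (ite_bool hc hf hg).of_eq fun a => by cases c a <;> rfl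

@[fun_prop]
theorem and {f g : α → Bool} (hf : PT f) (hg : PT g) : PT fun a => f a && g a :=
  (hf.cond hg (const false)).of_eq fun a => by cases f a <;> rfl

@[fun_prop]
theorem or {f g : α → Bool} (hf : PT f) (hg : PT g) : PT fun a => f a || g a :=
  (hf.cond (const true) hg).of_eq fun a => by cases f a <;> rfl

@[fun_prop]
theorem not {f : α → Bool} (hf : PT f) : PT fun a => !f a :=
  (hf.cond (const false) (const true)).of_eq fun a => by cases f a <;> rfl

@[fun_prop]
theorem beq {f g : α → Bool} (hf : PT f) (hg : PT g) : PT fun a => f a == g a :=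
  (hf.cond hg hg.not).of_eq fun a => by cases f a <;> cases g a <;> rfl

@[fun_prop]
theorem xor {f g : α → Bool} (hf : PT f) (hg : PT g) : PT fun a => Bool.xor (f a) (g a) :=
  (hf.cond hg.not hg).of_eq fun a => by cases f a <;> cases g a <;> rfl

/-- A fold in polynomial time, given a polynomial bound on the intermediate results. -/
theorem foldl_of_le {l : α → List β} {i : α → γ} {f : α → γ → β → γ} (hl : PT l) (hi : PT i)
    (hf : PT fun p : α × γ × β => f p.1 p.2.1 p.2.2) (Q : Polynomial ℕ)
    (hQ : ∀ a l₁ l₂, l a = l₁ ++ l₂ → esize (l₁.foldl (f a) (i a)) ≤ Q.eval (esize a)) :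
    PT fun a => (l a).foldl (f a) (i a) := by
  obtain ⟨L, hL⟩ := hl.esize_le
  obtain ⟨g, G, hg⟩ : PT fun p : (β × List β) × (α × γ) =>
      (p.1.2, (p.2.1, f p.2.1 p.2.2 p.1.1)) :=
    PT.prodMk (by fun_prop) (PT.prodMk (by fun_prop) (hf.comp (f := fun p : (β × List β) × (α × γ) =>
      (p.2.1, p.2.2, p.1.1)) (by fun_prop)))
  obtain ⟨p, P, hp⟩ : PT fun a => (l a, (a, i a)) := by fun_prop
  -- The loop test has popped the `true` of a list cell, leaving head, tail, and the pair of
  -- argument and accumulator. Two pushes assemble them into an input of `g`. Popping the leading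
  -- bit of the result exposes the remaining list to the next test.
  let body : Prog := .seq (.push .m true) (.seq (.push .m true) (.seq g (.case .m fun _ => .skip)))
  let B : Polynomial ℕ := L + X + Q + 3
  refine ⟨.seq p (.seq (.case .m fun _ => .loop .m (fun o => o != some true) fun _ => body) .right),
    P + ((1 + (L * (G.comp B + 5) + 1)) + (8 * (X + Q + 1) + 7)), fun a r => ?_⟩
  -- The processed part `l₁` is carried along because `hQ` bounds only folds over prefixes of `l a`.
  -- The constant 5 counts the loop test, two pushes, the pop and the `skip`.
  have loop : ∀ (l₂ l₁ : List β), l a = l₁ ++ l₂ →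
      RunsIn (.loop .m (fun o => o != some true) fun _ => body)
        ⟨(enc l₂).code ++ ((enc (a, l₁.foldl (f a) (i a))).code ++ r), [], [], []⟩
        ⟨(enc (a, (l a).foldl (f a) (i a))).code ++ r, [], [], []⟩
        (l₂.length * (G.eval (B.eval (esize a)) + 5) + 1) := by
    intro l₂
    induction l₂ with
    | nil =>
      intro l₁ h
      rw [List.append_nil] at h
      rw [h]
      exact (runsIn_quit rfl).mono (by simp)
    | cons b l₂ ih =>
      intro l₁ h
      have h3 := hg ((b, l₂), (a, l₁.foldl (f a) (i a))) r
      have h4 := ih (l₁ ++ [b]) (by simp [h])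
      rw [List.foldl_append, List.foldl_cons, List.foldl_nil] at h4
      have h5 : esize ((b, l₂), (a, l₁.foldl (f a) (i a))) ≤ B.eval (esize a) := by
        have e1 := hQ a l₁ _ h
        have e2 := hL a
        have e3 := esize_append l₁ (b :: l₂)
        rw [h] at e2
        have e4 := one_le_esize l₁
        rw [esize_cons] at e3
        simp only [esize_prod, B, Polynomial.eval_add, Polynomial.eval_X, Polynomial.eval_ofNat]
        omega
      have h6 := eval_mono G h5
      rw [code_prod_append] at h3
      simp only [code_prod_append, code_cons_append] at h3 h4 ⊢
      refine (RunsIn.iter rfl (((runsIn_push _ _ _).seq ((runsIn_push _ _ _).seq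
        ((h3.mono h6).seq (RunsIn.case (Runs.skip _).runsIn))))) h4).mono ?_
      rw [List.length_cons]
      apply le_of_eq
      ring
  have h1 := hp a r
  have h2 := runsIn_right (enc (a, (l a).foldl (f a) (i a))) r
  have h3 := loop (l a) [] rfl
  have h4 : ((enc (l a)).code ++ ((enc (a, i a)).code ++ r)) =
      ((enc (l a, (a, i a))).code ++ r).tail := by
    simp [enc, Tree.code]
  rw [List.foldl_nil, h4] at h3
  refine (h1.seq ((RunsIn.case h3).seq h2)).mono ?_
  have e1 := hQ a (l a) [] (by simp)
  have e2 := hL a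
  have e3 := length_le_esize (l a)
  have e4 : (enc (a, (l a).foldl (f a) (i a))).size ≤ esize a + Q.eval (esize a) + 1 := by
    have := esize_prod a ((l a).foldl (f a) (i a))
    rw [esize] at this
    omega
  have e5 := Nat.mul_le_mul_right (G.eval (B.eval (esize a)) + 5) (e3.trans e2)
  simp only [Polynomial.eval_add, Polynomial.eval_mul, Polynomial.eval_comp, Polynomial.eval_X,
    Polynomial.eval_ofNat, Polynomial.eval_one]
  omega

end PT

/-! ### List operations and case distinctions in polynomial time -/

namespace PT

open Polynomial (X)

variable {α β γ δ : Type} [Enc α] [Enc β] [Enc γ] [Enc δ]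

/-- A fold in polynomial time whose steps increase the size by a polynomial in the size of the
input only. -/
theorem foldl_of_add {l : α → List β} {i : α → γ} {f : α → γ → β → γ} (hl : PT l) (hi : PT i)
    (hf : PT fun p : α × γ × β => f p.1 p.2.1 p.2.2) (Q : Polynomial ℕ)
    (hQ : ∀ a s, ∀ b ∈ l a, esize (f a s b) ≤ esize s + Q.eval (esize a)) :
    PT fun a => (l a).foldl (f a) (i a) := by
  obtain ⟨L, hL⟩ := hl.esize_le
  obtain ⟨I, hI⟩ := hi.esize_le
  refine foldl_of_le hl hi hf (I + L * Q) fun a l₁ l₂ h => ?_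
  have key : ∀ l' : List β, ∀ s, (∀ b ∈ l', b ∈ l a) →
      esize (l'.foldl (f a) s) ≤ esize s + l'.length * Q.eval (esize a) := by
    intro l'
    induction l' with
    | nil => simp
    | cons b l' ih =>
      intro s hs
      have h1 := ih (f a s b) fun x hx => hs x (List.mem_cons_of_mem _ hx)
      have h2 := hQ a s b (hs b List.mem_cons_self)
      rw [List.foldl_cons, List.length_cons, Nat.add_mul]
      omega
  have h1 := key l₁ (i a) fun b hb => by rw [h]; exact List.mem_append_left _ hb
  have h2 : l₁.length ≤ L.eval (esize a) := by
    refine le_trans ?_ ((length_le_esize (l a)).trans (hL a))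
    rw [h]
    simp
  have h3 := Nat.mul_le_mul_right (Q.eval (esize a)) h2
  have h4 := hI a
  simp only [Polynomial.eval_add, Polynomial.eval_mul]
  omega

@[fun_prop]
theorem cons {f : α → β} {l : α → List β} (hf : PT f) (hl : PT l) : PT fun a => f a :: l a :=
  (hf.prodMk hl).of_enc fun _ => rfl

@[fun_prop]
theorem optionSome {f : α → β} (hf : PT f) : PT fun a => some (f a) :=
  (hf.prodMk (const ())).of_enc fun _ => rfl

/-- Whether a tree has children. -/
theorem isCons : PT fun t : Tree => decide (t ≠ Tree.nil) := by
  refine ⟨.case .m fun o => if o = some true then .seq .drop (.seq .drop (.seq (.push .m false)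
    (.seq (.push .m false) (.push .m true)))) else .push .m false, 8 * X + 10, fun t r => ?_⟩
  cases t with
  | nil => exact (RunsIn.case (runsIn_push _ _ _)).mono (by simp)
  | cons x y =>
    have h := code_prod_append x y r
    have h' : (enc (Tree.cons x y)).code ++ r = (enc (x, y)).code ++ r := rfl
    rw [h', h]
    refine (RunsIn.case ((runsIn_drop x (y.code ++ r)).seq ((runsIn_drop y r).seq ((runsIn_push _ _ _).seq
      ((runsIn_push _ _ _).seq (runsIn_push _ _ _)))))).mono ?_
    simp [esize, enc]
    omega

/-- A nonempty list has the same code as the pair of its head and tail, so after the test for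
emptiness the splitting is free. -/
theorem listCases {l : α → List β} {e : α → γ} {g : α × β × List β → γ} (hl : PT l) (he : PT e)
    (hg : PT g) : PT fun a => match l a with
      | [] => e a
      | b :: t => g (a, b, t) := by
  have hc : PT fun a => decide (enc (l a) ≠ Tree.nil) :=
    isCons.comp (f := fun a => enc (l a)) (hl.of_enc fun _ => rfl)
  have key : ∀ a : {a // decide (enc (l a) ≠ Tree.nil) = true}, l a.1 ≠ [] := by
    rintro ⟨a, h⟩ h'
    simp [h', enc] at h
  have hk : PT fun a : {a // decide (enc (l a) ≠ Tree.nil) = true} =>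
      (a.1, (l a.1).head (key a), (l a.1).tail) :=
    (subtype_val.prodMk (hl.comp subtype_val)).of_enc fun a => by
      conv_rhs => rw [← List.cons_head_tail (key a)]
      rfl
  refine (dite hc (hg.comp hk) (he.comp subtype_val)).of_eq fun a => ?_
  split_ifs with h
  · have h1 : ∀ (x : List β) (q : γ), (∀ hx : x ≠ [], q = g (a, x.head hx, x.tail)) → x ≠ [] →
        (match x with
        | [] => e a
        | b :: t => g (a, b, t)) = q := by
      rintro (_ | ⟨b, t⟩) q hq hx
      · exact absurd rfl hx
      · exact (hq hx).symm
    exact h1 (l a) _ (fun _ => rfl) (key ⟨a, h⟩)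
  · split <;> rename_i h1
    · rfl
    · simp [h1, enc] at h

theorem optionCases {l : α → Option β} {e : α → γ} {g : α × β → γ} (hl : PT l) (he : PT e)
    (hg : PT g) : PT fun a => match l a with
      | none => e a
      | some b => g (a, b) := by
  have hl' : PT fun a => (l a).toList := hl.of_enc fun a => by cases l a <;> rfl
  exact (listCases hl' he (hg.comp (f := fun p : α × β × List β => (p.1, p.2.1))
    (by fun_prop))).of_eq fun a => by cases l a <;> rfl

@[fun_prop]
theorem reverse {l : α → List β} (hl : PT l) : PT fun a => (l a).reverse := by
  obtain ⟨L, hL⟩ := hl.esize_le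
  refine (foldl_of_add (i := fun _ => []) (f := fun _ s b => b :: s) hl (by fun_prop) (by fun_prop)
    (L + 1) fun a s b hb => ?_).of_eq fun a => ?_
  · have := esize_le_of_mem hb
    have := hL a
    simp only [esize_cons, Polynomial.eval_add, Polynomial.eval_one]
    omega
  · simp

@[fun_prop]
theorem append {l l' : α → List β} (hl : PT l) (hl' : PT l') : PT fun a => l a ++ l' a := by
  obtain ⟨L, hL⟩ := hl.reverse.esize_le
  refine (foldl_of_add (f := fun _ s b => b :: s) hl.reverse hl' (by fun_prop)
    (L + 1) fun a s b hb => ?_).of_eq fun a => ?_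
  · have := esize_le_of_mem hb
    have := hL a
    simp only [esize_cons, Polynomial.eval_add, Polynomial.eval_one]
    omega
  · simp

/-- The fold puts results in front, hence the reversed list. The values of `f` are stored but never
fed back into it, so the growth per step depends on the input only. -/
theorem map {l : α → List β} {f : α → β → γ} (hl : PT l) (hf : PT fun p : α × β => f p.1 p.2) :
    PT fun a => (l a).map (f a) := by
  obtain ⟨L, hL⟩ := hl.reverse.esize_le
  obtain ⟨F, hF⟩ := hf.esize_le
  refine (foldl_of_add (i := fun _ => []) (f := fun a s b => f a b :: s) hl.reverse (const _)
    (cons (hf.comp (f := fun p : α × List γ × β => (p.1, p.2.2)) (by fun_prop)) (by fun_prop))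
    (F.comp (X + L + 1) + 1) fun a s b hb => ?_).of_eq fun a => ?_
  · have h1 := esize_le_of_mem hb
    have h2 := hL a
    have h3 := hF (a, b)
    have h4 : F.eval (esize (a, b)) ≤ F.eval (esize a + L.eval (esize a) + 1) :=
      eval_mono F (by rw [esize_prod]; omega)
    simp only [esize_cons, Polynomial.eval_add, Polynomial.eval_one, Polynomial.eval_comp,
      Polynomial.eval_X] at h3 ⊢
    omega
  · rw [List.foldl_reverse]
    induction l a <;> simp_all

theorem filter {l : α → List β} {f : α → β → Bool} (hl : PT l)
    (hf : PT fun p : α × β => f p.1 p.2) : PT fun a => (l a).filter (f a) := by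
  obtain ⟨L, hL⟩ := hl.reverse.esize_le
  refine (foldl_of_add (i := fun _ => []) (f := fun a s b => bif f a b then b :: s else s)
    hl.reverse (const _)
    (PT.cond (hf.comp (f := fun p : α × List β × β => (p.1, p.2.2)) (by fun_prop)) (by fun_prop)
      (by fun_prop))
    (L + 1) fun a s b hb => ?_).of_eq fun a => ?_
  · have := esize_le_of_mem hb
    have := hL a
    cases f a b <;> simp only [cond_true, cond_false, esize_cons, Polynomial.eval_add,
      Polynomial.eval_one] <;> omega
  · rw [List.foldl_reverse]
    induction l a with
    | nil => rfl
    | cons b t ih => rw [List.filter_cons, List.foldr_cons, ← ih]; cases f a b <;> rfl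

theorem tree_eq (t : Tree) : PT fun x : Tree => decide (x = t) := by
  induction t with
  | nil => exact isCons.not.of_eq fun x => by simp
  | cons t t' h h' =>
    refine (isCons.and ((h.comp treeLeft).and (h'.comp treeRight))).of_eq fun x => ?_
    cases x with
    | nil => simp
    | cons x y => by_cases h1 : x = t <;> by_cases h2 : y = t' <;> simp [Tree.left, Tree.right, h1, h2]

/-- A case distinction over finitely many values. -/
theorem finCases {σ : Type} [Enc σ] [Inhabited σ] {f : α → σ} {g : σ → α → β} (s : List σ)
    (hs : ∀ a, a ∈ s) (hinj : Function.Injective (enc : σ → Tree)) (hf : PT f) (hg : ∀ s, PT (g s)) :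
    PT fun a => g (f a) a := by
  -- A chain of comparisons with the members of `s`. The value at `default` ends the chain and is
  -- never used for a value in `s`.
  have key : ∀ s : List σ, ∃ F : α → β, PT F ∧ ∀ a, f a ∈ s → F a = g (f a) a := by
    intro s
    induction s with
    | nil => exact ⟨g default, hg _, by simp⟩
    | cons c s ih =>
      obtain ⟨F, hF, h⟩ := ih
      refine ⟨fun a => bif decide (enc (f a) = enc c) then g c a else F a, PT.cond
        ((tree_eq (enc c)).comp (f := fun a => enc (f a)) (hf.of_enc fun _ => rfl)) (hg c) hF,
        fun a ha => ?_⟩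
      by_cases hc : f a = c
      · simp [hc]
      · have : enc (f a) ≠ enc c := fun e => hc (hinj e)
        simp only [this, decide_false, cond_false]
        exact h a (by simpa [hc] using ha)
  obtain ⟨F, hF, h⟩ := key s
  exact hF.of_eq fun a => (h a (hs _)).symm

end PT

/-! ### Pairs of lists -/

/-- The pairs of entries at the same position, `none` standing for a missing entry. -/
def zipPad {α β : Type} : List α → List β → List (Option α × Option β)
  | [], l' => l'.map fun b => (none, some b)
  | a :: l, [] => (some a, none) :: zipPad l []
  | a :: l, b :: l' => (some a, some b) :: zipPad l l'

theorem length_zipPad {α β : Type} (l : List α) (l' : List β) :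
    (zipPad l l').length = max l.length l'.length := by
  induction l generalizing l' with
  | nil => simp [zipPad]
  | cons a l ih => cases l' <;> simp [zipPad, ih]

theorem getElem?_zipPad {α β : Type} (l : List α) (l' : List β) (i : ℕ) :
    (zipPad l l')[i]? = if i < max l.length l'.length then some (l[i]?, l'[i]?) else none := by
  induction l generalizing l' i with
  | nil =>
    simp only [zipPad, List.getElem?_map, List.length_nil, zero_le, sup_of_le_right,
      List.getElem?_nil]
    split_ifs with h
    · simp [h]
    · simp [not_lt.1 h]
  | cons a l ih => cases l' <;> cases i <;> simp [zipPad, ih]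

/-- The fold runs along the first list and consumes the second, which is part of the accumulator.
What is left of the second is appended afterwards, padded with `none`. -/
theorem PT.zipPad {α β γ : Type} [Enc α] [Enc β] [Enc γ] {l : α → List β} {l' : α → List γ}
    (hl : PT l) (hl' : PT l') : PT fun a => zipPad (l a) (l' a) := by
  obtain ⟨L, hL⟩ := hl.esize_le
  let step : List (Option β × Option γ) × List γ → β → List (Option β × Option γ) × List γ :=
    fun s b => match s.2 with
      | [] => ((some b, none) :: s.1, [])
      | c :: t => ((some b, some c) :: s.1, t)
  have h1 : PT fun p : α × (List (Option β × Option γ) × List γ) × β => step p.2.1 p.2.2 :=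
    listCases (l := fun p : α × (List (Option β × Option γ) × List γ) × β => p.2.1.2)
      (e := fun p => ((some p.2.2, none) :: p.2.1.1, []))
      (g := fun q => ((some q.1.2.2, some q.2.1) :: q.1.2.1.1, q.2.2))
      (by fun_prop) (by fun_prop) (by fun_prop)
  have h2 := foldl_of_add (i := fun a => ([], l' a)) (f := fun _ => step) hl (by fun_prop) h1
    (L + 9) (by
      rintro a ⟨s, t⟩ b hb
      have e1 := esize_le_of_mem hb
      have e2 := hL a
      cases t <;> simp only [step, esize_prod, esize_cons, esize_nil, esize_none, esize_some,
        Polynomial.eval_add, Polynomial.eval_ofNat] <;> omega)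
  have h3 := h2.fst.reverse.append (PT.map h2.snd (f := fun _ c =>
    ((none : Option β), some c)) (by fun_prop))
  refine h3.of_eq fun a => ?_
  have key : ∀ (x : List β) (s : List (Option β × Option γ)) (y : List γ),
      (x.foldl step (s, y)).1.reverse ++ (x.foldl step (s, y)).2.map (fun c => (none, some c)) =
        s.reverse ++ CECAC.zipPad x y := by
    intro x
    induction x with
    | nil => intro s y; simp [CECAC.zipPad]
    | cons b x ih =>
      intro s y
      cases y <;> simp only [List.foldl_cons, step, ih, CECAC.zipPad, List.reverse_cons,
        List.append_assoc, List.cons_append, List.nil_append]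
  exact (key (l a) [] (l' a)).symm

attribute [fun_prop] PT.zipPad

/-! ### Binary numbers -/

/-- The number with the given binary digits, lowest first. -/
def val : List Bool → ℕ
  | [] => 0
  | b :: l => b.toNat + 2 * val l

theorem val_append (x y : List Bool) : val (x ++ y) = val x + 2 ^ x.length * val y := by
  induction x with
  | nil => simp [val]
  | cons b x ih => simp only [List.cons_append, val, ih, List.length_cons, pow_succ]; ring

theorem val_encodeNat (n : ℕ) : val (Computability.encodeNat n) = n := by
  have key : ∀ p : PosNum, val (Computability.encodePosNum p) = (p : ℕ) := by
    intro p
    induction p with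
    | one => rfl
    | bit1 p ih => simp [Computability.encodePosNum, val, ih, PosNum.cast_bit1]; omega
    | bit0 p ih => simp [Computability.encodePosNum, val, ih, PosNum.cast_bit0]; omega
  have h : ((n : Num) : ℕ) = n := Num.to_of_nat n
  conv_rhs => rw [← h]
  unfold Computability.encodeNat
  generalize (n : Num) = m
  cases m with
  | zero => rfl
  | pos p => exact key p

theorem val_fst_zipPad (x y : List Bool) :
    val ((zipPad x y).map fun p => p.1.getD false) = val x := by
  induction x generalizing y with
  | nil => induction y with
    | nil => rfl
    | cons b y ih => simpa [zipPad, val] using ih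
  | cons a x ih => cases y <;> simp [zipPad, val, ih]

theorem val_snd_zipPad (x y : List Bool) :
    val ((zipPad x y).map fun p => p.2.getD false) = val y := by
  induction x generalizing y with
  | nil => induction y with
    | nil => rfl
    | cons b y ih => simpa [zipPad, val] using ih
  | cons a x ih =>
    cases y with
    | nil => simpa [zipPad, val] using ih []
    | cons b y => simp [zipPad, val, ih]

/-- Addition of one digit: the state consists of the carry and the digits so far, highest first. -/
def addStep (s : Bool × List Bool) (p : Option Bool × Option Bool) : Bool × List Bool :=
  ((p.1.getD false && p.2.getD false) || (s.1 && (p.1.getD false || p.2.getD false)),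
    Bool.xor (p.1.getD false) (Bool.xor (p.2.getD false) s.1) :: s.2)

/-- Addition of binary numbers. -/
def addBits (x y : List Bool) : List Bool :=
  (bif ((zipPad x y).foldl addStep (false, [])).1
    then true :: ((zipPad x y).foldl addStep (false, [])).2
    else ((zipPad x y).foldl addStep (false, [])).2).reverse

theorem val_addBits (x y : List Bool) : val (addBits x y) = val x + val y := by
  -- Invariant: the digits already produced have their full value, while the carry and the unread
  -- digits are weighted by the power of two of the current position.
  have key : ∀ (z : List (Option Bool × Option Bool)) (s : Bool × List Bool),
      val (bif (z.foldl addStep s).1 then true :: (z.foldl addStep s).2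
        else (z.foldl addStep s).2).reverse = val s.2.reverse + 2 ^ s.2.length *
        (s.1.toNat + val (z.map fun p => p.1.getD false) + val (z.map fun p => p.2.getD false)) := by
    intro z
    induction z with
    | nil =>
      rintro ⟨c, o⟩
      cases c <;> simp [val, val_append]
    | cons p z ih =>
      rintro ⟨c, o⟩
      rw [List.foldl_cons, ih]
      simp only [addStep, List.reverse_cons, val_append, List.length_reverse, List.length_cons,
        List.map_cons, val, pow_succ]
      generalize val (z.map fun p => p.1.getD false) = u
      generalize val (z.map fun p => p.2.getD false) = v
      rcases p with ⟨p, q⟩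
      cases c <;> cases p.getD false <;> cases q.getD false <;> simp <;> ring
  have := key (zipPad x y) (false, [])
  rw [val_fst_zipPad, val_snd_zipPad] at this
  simpa [val, addBits] using this

theorem length_addBits_le (x y : List Bool) :
    (addBits x y).length ≤ max x.length y.length + 1 := by
  have key : ∀ (z : List (Option Bool × Option Bool)) (s : Bool × List Bool),
      (z.foldl addStep s).2.length = s.2.length + z.length := by
    intro z
    induction z with
    | nil => simp
    | cons p z ih =>
      intro s
      rw [List.foldl_cons, ih]
      simp only [addStep, List.length_cons]
      omega
  have := key (zipPad x y) (false, [])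
  rw [length_zipPad] at this
  unfold addBits
  cases ((zipPad x y).foldl addStep (false, [])).1 <;> simp_all

/-- Comparison of binary numbers. -/
def leBits (x y : List Bool) : Bool :=
  (zipPad x y).foldl (fun r p => bif p.1.getD false == p.2.getD false then r else p.2.getD false) true

theorem leBits_iff (x y : List Bool) : leBits x y = true ↔ val x ≤ val y := by
  -- Digits come lowest first, so a later difference overrides the verdict `r` on the digits already
  -- read.
  have key : ∀ (z : List (Option Bool × Option Bool)) (r : Bool),
      z.foldl (fun r p => bif p.1.getD false == p.2.getD false then r else p.2.getD false) r = true ↔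
        val (z.map fun p => p.1.getD false) < val (z.map fun p => p.2.getD false) ∨
        (val (z.map fun p => p.1.getD false) = val (z.map fun p => p.2.getD false) ∧ r = true) := by
    intro z
    induction z with
    | nil => simp [val]
    | cons p z ih =>
      intro r
      rw [List.foldl_cons, ih]
      simp only [List.map_cons, val]
      generalize val (z.map fun p => p.1.getD false) = u
      generalize val (z.map fun p => p.2.getD false) = v
      rcases p with ⟨p, q⟩
      cases r <;> cases p.getD false <;> cases q.getD false <;> simp <;> omega
  rw [leBits, key, val_fst_zipPad, val_snd_zipPad]
  simp
  omega

/-- Equality of binary numbers. -/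
def eqBits (x y : List Bool) : Bool := leBits x y && leBits y x

theorem eqBits_iff (x y : List Bool) : eqBits x y = true ↔ val x = val y := by
  simp only [eqBits, Bool.and_eq_true, leBits_iff]
  omega

/-! ### Integers, as differences -/

/-- The code of an integer: it is the difference of the two numbers. -/
abbrev Num : Type := List Bool × List Bool

/-- The integer with a given code. -/
def ival (n : Num) : ℤ := val n.1 - val n.2

/-- Addition. -/
def addNum (m n : Num) : Num := (addBits m.1 n.1, addBits m.2 n.2)

theorem ival_addNum (m n : Num) : ival (addNum m n) = ival m + ival n := by
  simp only [ival, addNum, val_addBits]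
  push_cast
  ring

/-- Comparison. -/
def leNum (m n : Num) : Bool := leBits (addBits m.1 n.2) (addBits n.1 m.2)

/-- Adding the subtrahends crosswise to both sides makes digitwise subtraction unnecessary. -/
theorem leNum_iff (m n : Num) : leNum m n = true ↔ ival m ≤ ival n := by
  simp only [ival, leNum, leBits_iff, val_addBits]
  omega

/-- The number of digits is at most `W`. -/
def NumBdd (W : ℕ) (n : Num) : Prop := n.1.length ≤ W ∧ n.2.length ≤ W

theorem NumBdd.mono {W W' : ℕ} {n : Num} (h : NumBdd W n) (hW : W ≤ W') : NumBdd W' n :=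
  ⟨h.1.trans hW, h.2.trans hW⟩

theorem NumBdd.addNum {W : ℕ} {m n : Num} (hm : NumBdd W m) (hn : NumBdd W n) :
    NumBdd (W + 1) (addNum m n) :=
  ⟨(length_addBits_le _ _).trans (by simpa using ⟨hm.1, hn.1⟩),
    (length_addBits_le _ _).trans (by simpa using ⟨hm.2, hn.2⟩)⟩

/-! ### Polynomials over the max-plus semiring -/

/-- Maximum, `none` being minus infinity. -/
def maxNum : Option Num → Option Num → Option Num
  | none, y => y
  | some m, none => some m
  | some m, some n => bif leNum m n then some n else some m

/-- Sum, `none` being minus infinity. -/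
def addONum : Option Num → Option Num → Option Num
  | some m, some n => some (addNum m n)
  | _, _ => none

/-- A table lists a value (or `none`, for minus infinity) for each committee size. -/
abbrev Tab : Type := List (Option Num)

/-- The entry at `j` is at least `v`. -/
def Sat (t : Tab) (j : ℕ) (v : ℤ) : Prop := ∃ n, t[j]? = some (some n) ∧ v ≤ ival n

theorem sat_nil (j : ℕ) (v : ℤ) : ¬ Sat [] j v := by
  simp [Sat]

theorem sat_cons_zero (o : Option Num) (t : Tab) (v : ℤ) :
    Sat (o :: t) 0 v ↔ ∃ n, o = some n ∧ v ≤ ival n := by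
  simp [Sat]

theorem sat_cons_succ (o : Option Num) (t : Tab) (j : ℕ) (v : ℤ) :
    Sat (o :: t) (j + 1) v ↔ Sat t j v := by
  simp [Sat]

/-- Entrywise maximum. -/
def pmax (s t : Tab) : Tab := (zipPad s t).map fun p => maxNum p.1.join p.2.join

/-- Describing an entry by the thresholds that it reaches turns a maximum into a disjunction and
treats minus infinity uniformly. -/
theorem sat_pmax (s t : Tab) (j : ℕ) (v : ℤ) : Sat (pmax s t) j v ↔ Sat s j v ∨ Sat t j v := by
  have key : ∀ o o' : Option Num, (∃ n, maxNum o o' = some n ∧ v ≤ ival n) ↔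
      (∃ n, o = some n ∧ v ≤ ival n) ∨ ∃ n, o' = some n ∧ v ≤ ival n := by
    rintro (_ | m) (_ | n)
    · simp [maxNum]
    · simp [maxNum]
    · simp [maxNum]
    · have := leNum_iff m n
      rcases h : leNum m n <;> simp [maxNum, h] at this ⊢ <;> omega
  have hj : ∀ (t : Tab), Sat t j v ↔ ∃ n, t[j]?.join = some n ∧ v ≤ ival n := by
    intro t
    simp [Sat, Option.join_eq_some_iff]
  rw [hj s, hj t, ← key, Sat]
  simp only [pmax, List.getElem?_map, getElem?_zipPad]
  split_ifs with h
  · simp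
  · have h1 : s[j]? = none := by simp; omega
    have h2 : t[j]? = none := by simp; omega
    simp [h1, h2, maxNum]

/-- Multiplication. -/
def mul (s t : Tab) : Tab :=
  s.foldr (fun o acc => pmax (t.map fun o' => addONum o o') (none :: acc)) []

/-- The max-plus convolution, with thresholds in place of maxima. The recursion is (o + Xs)t = ot +
X(st), the prefixed `none` being the shift by X. -/
theorem sat_mul (s t : Tab) (j : ℕ) (v : ℤ) : Sat (mul s t) j v ↔
    ∃ i i' u u', i + i' = j ∧ Sat s i u ∧ Sat t i' u' ∧ v ≤ u + u' := by
  induction s generalizing j with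
  | nil => simp [mul, sat_nil]
  | cons o s ih =>
    have h1 : mul (o :: s) t = pmax (t.map fun o' => addONum o o') (none :: mul s t) := rfl
    rw [h1, sat_pmax]
    have h2 : Sat (t.map fun o' => addONum o o') j v ↔
        ∃ u u', Sat (o :: s) 0 u ∧ Sat t j u' ∧ v ≤ u + u' := by
      simp only [sat_cons_zero]
      simp only [Sat, List.getElem?_map, Option.map_eq_some_iff]
      constructor
      · rintro ⟨n, ⟨o', h, h'⟩, hv⟩
        rcases o with _ | m
        · simp [addONum] at h'
        · rcases o' with _ | m'
          · simp [addONum] at h'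
          · simp only [addONum, Option.some.injEq] at h'
            subst h'
            rw [ival_addNum] at hv
            exact ⟨_, _, ⟨m, rfl, le_rfl⟩, ⟨m', h, le_rfl⟩, hv⟩
      · rintro ⟨u, u', ⟨m, rfl, hm⟩, ⟨m', h, hm'⟩, hv⟩
        refine ⟨_, ⟨_, h, rfl⟩, ?_⟩
        rw [ival_addNum]
        omega
    rw [h2]
    constructor
    · rintro (⟨u, u', h, h', hv⟩ | h)
      · exact ⟨0, j, u, u', by simp, h, h', hv⟩
      · rcases j with _ | j
        · simp [sat_cons_zero] at h
        · rw [sat_cons_succ, ih] at h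
          obtain ⟨i, i', u, u', hi, h, h', hv⟩ := h
          exact ⟨i + 1, i', u, u', by omega, (sat_cons_succ _ _ _ _).2 h, h', hv⟩
    · rintro ⟨i, i', u, u', hi, h, h', hv⟩
      rcases i with _ | i
      · rw [zero_add] at hi
        subst hi
        exact Or.inl ⟨u, u', h, h', hv⟩
      · subst hi
        right
        rw [show i + 1 + i' = (i + i') + 1 by omega, sat_cons_succ, ih]
        exact ⟨i, i', u, u', rfl, (sat_cons_succ _ _ _ _).1 h, h', hv⟩

/-- The product of the polynomials `1 + s X`, for the profits `s` in a list. -/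
def prodTab (l : List Num) : Tab :=
  l.foldr (fun s acc => mul [some ([], []), some s] acc) [some ([], [])]

/-- At most `L` entries with at most `W` digits. -/
def TabBdd (L W : ℕ) (t : Tab) : Prop := t.length ≤ L ∧ ∀ n, some n ∈ t → NumBdd W n

theorem TabBdd.mono {L L' W W' : ℕ} {t : Tab} (h : TabBdd L W t) (hL : L ≤ L') (hW : W ≤ W') :
    TabBdd L' W' t :=
  ⟨h.1.trans hL, fun n hn => (h.2 n hn).mono hW⟩

theorem TabBdd.cons {L W : ℕ} {t : Tab} (h : TabBdd L W t) {o : Option Num}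
    (ho : ∀ n, o = some n → NumBdd W n) : TabBdd (L + 1) W (o :: t) :=
  ⟨by simpa using h.1, fun n hn => by
    rcases List.mem_cons.1 hn with hn | hn
    · exact ho n hn.symm
    · exact h.2 n hn⟩

theorem tabBdd_one (W : ℕ) : TabBdd 1 W [some ([], [])] := by
  refine ⟨le_rfl, fun n hn => ?_⟩
  obtain rfl : n = ([], []) := by simpa using hn
  exact ⟨Nat.zero_le _, Nat.zero_le _⟩

/-- A maximum selects one of its arguments, so no digits are added. -/
theorem TabBdd.pmax {L L' W : ℕ} {s t : Tab} (hs : TabBdd L W s) (ht : TabBdd L' W t) :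
    TabBdd (max L L') W (pmax s t) := by
  constructor
  · simp only [CECAC.pmax, List.length_map, length_zipPad]
    exact max_le_max hs.1 ht.1
  · intro n hn
    obtain ⟨i, hi⟩ := List.mem_iff_getElem?.1 hn
    simp only [CECAC.pmax, List.getElem?_map, getElem?_zipPad] at hi
    split_ifs at hi with h
    · simp only [Option.map_some, Option.some.injEq] at hi
      have h1 : s[i]?.join = some n ∨ t[i]?.join = some n := by
        generalize s[i]?.join = o at hi
        generalize t[i]?.join = o' at hi
        rcases o with _ | m <;> rcases o' with _ | m' <;> simp only [maxNum] at hi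
        · simp at hi
        · exact Or.inr hi
        · exact Or.inl hi
        · cases h : leNum m m' <;> simp [h] at hi <;> simp [hi]
      rcases h1 with h1 | h1 <;> rw [Option.join_eq_some_iff] at h1
      · exact hs.2 n (List.mem_of_getElem? h1)
      · exact ht.2 n (List.mem_of_getElem? h1)
    · simp at hi

/-- An entry is a maximum of sums of two entries, one from each factor. Only one addition enters,
hence one more digit regardless of the table lengths. -/
theorem TabBdd.mul {L L' W : ℕ} {s t : Tab} (hs : TabBdd L W s) (ht : TabBdd L' W t) :
    TabBdd (L + L') (W + 1) (mul s t) := by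
  have key : ∀ s : Tab, (∀ n, some n ∈ s → NumBdd W n) →
      TabBdd (s.length + L') (W + 1) (CECAC.mul s t) := by
    intro s
    induction s with
    | nil => exact fun _ => ⟨Nat.zero_le _, by simp [CECAC.mul]⟩
    | cons o s ih =>
      intro h
      have h1 := (ih fun n hn => h n (List.mem_cons_of_mem _ hn)).cons (o := none) (by simp)
      have h2 : TabBdd L' (W + 1) (t.map fun o' => addONum o o') := by
        refine ⟨by simpa using ht.1, fun n hn => ?_⟩
        obtain ⟨o', ho', e⟩ := List.mem_map.1 hn
        rcases o with _ | m
        · simp [addONum] at e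
        · rcases o' with _ | m'
          · simp [addONum] at e
          · simp only [addONum, Option.some.injEq] at e
            subst e
            exact (h m List.mem_cons_self).addNum (ht.2 _ ho')
      refine (h2.pmax h1).mono ?_ le_rfl
      simp only [List.length_cons]
      omega
  exact (key s hs.2).mono (by have := hs.1; omega) le_rfl

theorem tabBdd_prodTab {W : ℕ} (l : List Num) (h : ∀ n ∈ l, NumBdd W n) :
    TabBdd (2 * l.length + 1) (W + l.length) (prodTab l) := by
  induction l with
  | nil => exact tabBdd_one _
  | cons s l ih =>
    have h1 : TabBdd 2 (W + l.length) [some ([], []), some s] := by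
      refine ⟨le_rfl, fun n hn => ?_⟩
      simp only [List.mem_cons, Option.some.injEq, List.not_mem_nil, or_false] at hn
      rcases hn with rfl | rfl
      · exact ⟨Nat.zero_le _, Nat.zero_le _⟩
      · exact (h _ List.mem_cons_self).mono (by omega)
    refine (h1.mul (ih fun n hn => h n (List.mem_cons_of_mem _ hn))).mono ?_ ?_ <;>
      simp only [List.length_cons] <;> omega

theorem esize_bits_le (x : List Bool) : esize x ≤ 4 * x.length + 1 := by
  induction x with
  | nil => simp [esize_nil]
  | cons b x ih =>
    have := esize_bool_le b
    rw [esize_cons, List.length_cons]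
    omega

theorem NumBdd.esize_le {W : ℕ} {n : Num} (h : NumBdd W n) : esize n ≤ 8 * W + 3 := by
  have h1 := esize_bits_le n.1
  have h2 := esize_bits_le n.2
  have h3 := h.1
  have h4 := h.2
  have h5 : esize n = esize n.1 + esize n.2 + 1 := esize_prod n.1 n.2
  omega

theorem esize_list_le {α : Type} [Enc α] {B : ℕ} (l : List α) (h : ∀ a ∈ l, esize a ≤ B) :
    esize l ≤ l.length * (B + 1) + 1 := by
  induction l with
  | nil => simp [esize_nil]
  | cons a l ih =>
    have h1 := ih fun x hx => h x (List.mem_cons_of_mem _ hx)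
    have h2 := h a List.mem_cons_self
    rw [esize_cons, List.length_cons, Nat.add_mul]
    omega

theorem TabBdd.esize_le {L W : ℕ} {t : Tab} (h : TabBdd L W t) :
    esize t ≤ L * (8 * W + 6) + 1 := by
  have h1 : ∀ o ∈ t, esize o ≤ 8 * W + 5 := by
    rintro (_ | n) ho
    · rw [esize_none]
      omega
    · rw [esize_some]
      have := (h.2 n ho).esize_le
      omega
  refine (esize_list_le t h1).trans ?_
  rw [show 8 * W + 5 + 1 = 8 * W + 6 from rfl]
  have := Nat.mul_le_mul_right (8 * W + 6) h.1
  omega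

/-! ### Arithmetic of numbers and tables in polynomial time -/

namespace PT

open Polynomial (X)

variable {α β γ : Type} [Enc α] [Enc β] [Enc γ]

@[fun_prop]
theorem getD {o : α → Option β} {d : α → β} (ho : PT o) (hd : PT d) :
    PT fun a => (o a).getD (d a) :=
  (optionCases ho hd (g := fun p => p.2) (by fun_prop)).of_eq fun a => by cases o a <;> rfl

@[fun_prop]
theorem join {o : α → Option (Option β)} (ho : PT o) : PT fun a => (o a).join :=
  (optionCases ho (const none) (g := fun p => p.2) (by fun_prop)).of_eq fun a => by
    cases o a <;> rfl

@[fun_prop]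
theorem addBits {x y : α → List Bool} (hx : PT x) (hy : PT y) : PT fun a => addBits (x a) (y a) := by
  have h := foldl_of_add (i := fun _ => (false, [])) (f := fun _ => addStep)
    (hx.zipPad hy) (const _) (by unfold addStep; fun_prop) 10 (by
      rintro a ⟨c, o⟩ p -
      have h1 := one_le_esize c
      have h2 := esize_bool_le (addStep (c, o) p).1
      have h3 := esize_bool_le (Bool.xor (p.1.getD false) (Bool.xor (p.2.getD false) c))
      have h4 : esize (addStep (c, o) p) = esize (addStep (c, o) p).1 + (esize
        (Bool.xor (p.1.getD false) (Bool.xor (p.2.getD false) c)) + esize o + 1) + 1 := by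
        rw [← esize_cons, ← esize_prod]
        rfl
      have h5 := esize_prod c o
      simp only [Polynomial.eval_ofNat]
      omega)
  unfold CECAC.addBits
  fun_prop

@[fun_prop]
theorem leBits {x y : α → List Bool} (hx : PT x) (hy : PT y) : PT fun a => leBits (x a) (y a) :=
  (foldl_of_add (i := fun _ => true)
    (f := fun _ r (p : Option Bool × Option Bool) => bif p.1.getD false == p.2.getD false then r else p.2.getD false)
    (hx.zipPad hy) (const _) (by fun_prop) 3 (by
      rintro a r p -
      refine (esize_bool_le _).trans ?_
      simp)).of_eq fun a => rfl

@[fun_prop]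
theorem eqBits {x y : α → List Bool} (hx : PT x) (hy : PT y) : PT fun a => eqBits (x a) (y a) := by
  unfold CECAC.eqBits
  fun_prop

@[fun_prop]
theorem addNum {x y : α → Num} (hx : PT x) (hy : PT y) : PT fun a => addNum (x a) (y a) := by
  unfold CECAC.addNum
  fun_prop

@[fun_prop]
theorem leNum {x y : α → Num} (hx : PT x) (hy : PT y) : PT fun a => leNum (x a) (y a) := by
  unfold CECAC.leNum
  fun_prop

@[fun_prop]
theorem maxNum {x y : α → Option Num} (hx : PT x) (hy : PT y) : PT fun a => maxNum (x a) (y a) :=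
  (optionCases hx hy (optionCases (l := fun p : α × Num => y p.1) (e := fun p => some p.2)
    (g := fun q => bif CECAC.leNum q.1.2 q.2 then some q.2 else some q.1.2) (by fun_prop)
    (by fun_prop) (by fun_prop))).of_eq fun a => by
      cases h : x a <;> cases h' : y a <;> simp [CECAC.maxNum, h']

@[fun_prop]
theorem addONum {x y : α → Option Num} (hx : PT x) (hy : PT y) :
    PT fun a => addONum (x a) (y a) :=
  (optionCases hx (const none) (optionCases (l := fun p : α × Num => y p.1) (e := fun p => none)
    (g := fun q => some (CECAC.addNum q.1.2 q.2)) (by fun_prop)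
    (by fun_prop) (by fun_prop))).of_eq fun a => by
      cases h : x a <;> cases h' : y a <;> simp [CECAC.addONum, h']

@[fun_prop]
theorem pmax {s t : α → Tab} (hs : PT s) (ht : PT t) : PT fun a => pmax (s a) (t a) :=
  (map (f := fun _ (p : Option (Option Num) × Option (Option Num)) =>
    CECAC.maxNum p.1.join p.2.join) (hs.zipPad ht) (by fun_prop)).of_eq fun a => rfl

/-- Because a maximum selects, sizes at worst add up. This lets the fold behind `mul` grow
additively. -/
theorem _root_.CECAC.esize_pmax_le (s t : Tab) : esize (CECAC.pmax s t) ≤ esize s + esize t := by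
  have key : ∀ o o' : Option Num, esize (CECAC.maxNum o o') ≤ max (esize o) (esize o') := by
    rintro (_ | m) (_ | n) <;> simp only [CECAC.maxNum]
    · simp
    · exact le_max_right _ _
    · exact le_max_left _ _
    · cases CECAC.leNum m n
      · exact le_max_left _ _
      · exact le_max_right _ _
  induction s generalizing t with
  | nil =>
    have : CECAC.pmax [] t = t := by
      simp only [CECAC.pmax, CECAC.zipPad, List.map_map]
      conv_rhs => rw [← List.map_id t]
      rfl
    rw [this]
    omega
  | cons o s ih =>
    rcases t with _ | ⟨o', t⟩
    · have h := ih []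
      have h1 := key o none
      have h2 := one_le_esize o
      have h3 : CECAC.pmax (o :: s) [] = CECAC.maxNum o none :: CECAC.pmax s [] := rfl
      rw [h3, esize_cons, esize_cons]
      rw [esize_none] at h1
      omega
    · have h := ih t
      have h1 := key o o'
      have h3 : CECAC.pmax (o :: s) (o' :: t) = CECAC.maxNum o o' :: CECAC.pmax s t := rfl
      rw [h3, esize_cons, esize_cons, esize_cons]
      omega

@[fun_prop]
theorem mul {s t : α → Tab} (hs : PT s) (ht : PT t) : PT fun a => mul (s a) (t a) := by
  have hf : PT fun p : α × Option Num => (t p.1).map fun o' => CECAC.addONum p.2 o' :=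
    map (l := fun p : α × Option Num => t p.1) (f := fun p o' => CECAC.addONum p.2 o') (by fun_prop)
      (by fun_prop)
  obtain ⟨F, hF⟩ := hf.esize_le
  obtain ⟨L, hL⟩ := hs.esize_le
  refine (foldl_of_add (l := fun a => (s a).reverse) (i := fun _ => ([] : Tab))
    (f := fun a acc o => CECAC.pmax ((t a).map fun o' => CECAC.addONum o o') (none :: acc))
    hs.reverse (const _)
    (pmax (hf.comp (f := fun p : α × Tab × Option Num => (p.1, p.2.2)) (by fun_prop)) (by fun_prop))
    (F.comp (X + L + 1) + 2) fun a acc o ho => ?_).of_eq fun a => ?_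
  · have h1 := esize_pmax_le ((t a).map fun o' => CECAC.addONum o o') (none :: acc)
    have h2 := hF (a, o)
    have h3 := esize_le_of_mem (List.mem_reverse.1 ho)
    have h4 := hL a
    have h5 : F.eval (esize (a, o)) ≤ F.eval (esize a + L.eval (esize a) + 1) :=
      eval_mono F (by rw [esize_prod]; omega)
    rw [esize_cons, esize_none] at h1
    simp only [Polynomial.eval_add, Polynomial.eval_one, Polynomial.eval_comp,
      Polynomial.eval_X, Polynomial.eval_ofNat] at h2 ⊢
    omega
  · rw [List.foldl_reverse]
    rfl

-- Iterating the size bound of a single multiplication would not yield a polynomial. Instead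
-- `tabBdd_prodTab` bounds every partial product directly.
@[fun_prop]
theorem prodTab {l : α → List Num} (hl : PT l) : PT fun a => prodTab (l a) := by
  obtain ⟨L, hL⟩ := hl.esize_le
  refine (foldl_of_le (l := fun a => (l a).reverse) (i := fun _ => [some ([], [])])
    (f := fun _ acc s => CECAC.mul [some ([], []), some s] acc) hl.reverse (const _)
    (by fun_prop) ((2 * L + 1) * (8 * (L + L) + 6) + 1) fun a l₁ l₂ h => ?_).of_eq fun a => ?_
  · have h1 : l a = l₂.reverse ++ l₁.reverse := by
      rw [← List.reverse_append, ← h, List.reverse_reverse]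
    have h2 : ∀ n ∈ l₁.reverse, NumBdd (L.eval (esize a)) n := by
      intro n hn
      have h3 : esize n ≤ L.eval (esize a) :=
        (esize_le_of_mem (h1 ▸ List.mem_append_right _ hn)).trans (hL a)
      have h4 : esize n = esize n.1 + esize n.2 + 1 := esize_prod n.1 n.2
      have h5 := length_le_esize n.1
      have h6 := length_le_esize n.2
      exact ⟨by omega, by omega⟩
    have h3 := tabBdd_prodTab _ h2
    have h4 : l₁.reverse.length ≤ L.eval (esize a) := by
      refine le_trans ?_ ((length_le_esize (l a)).trans (hL a))
      rw [h1, List.length_append]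
      omega
    have h5 := (h3.mono (L' := 2 * L.eval (esize a) + 1)
      (W' := L.eval (esize a) + L.eval (esize a)) (by omega) (by omega)).esize_le
    rw [CECAC.prodTab, List.foldr_reverse] at h5
    simpa using h5
  · rw [List.foldl_reverse]
    rfl

end PT

/-! ### The decision procedure -/

/-- The position of a symbol in the alphabet. -/
def symIndex : Sym → ℕ
  | .bit false => 0
  | .bit true => 1
  | .fin => 2
  | .plus => 3
  | .minus => 4
  | .pos => 5
  | .neg => 6
  | .and => 7
  | .or => 8
  | .imp => 9
  | .cand => 10
  | .attr => 11

instance : Enc Sym := ⟨fun x => enc (List.replicate (symIndex x) ())⟩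

instance : Inhabited Sym := ⟨.fin⟩

theorem enc_sym_injective : Function.Injective (enc : Sym → Tree) := by decide

/-- The candidate's attribute, if any, and profit. -/
abbrev CandCode : Type := Option (List Bool) × Num

/-- The state of the decision procedure, which reads the input backwards. -/
structure St : Type where
  /-- the digits of the number that is being read -/
  bits : List Bool
  /-- the numbers read before -/
  nums : List (List Bool)
  /-- the attribute of the candidate that is being read -/
  attr : Option (List Bool)
  /-- the profit of the candidate that is being read -/
  prof : Num
  /-- the candidates whose attribute has not occurred in a constraint -/
  cands : List CandCode
  /-- the best profits for making the formulas that wait for their connective true or false -/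
  stk : List (Tab × Tab)

/-- The components of a state. -/
def St.toProd (s : St) : List Bool × List (List Bool) × Option (List Bool) × Num ×
    List CandCode × List (Tab × Tab) := (s.bits, s.nums, s.attr, s.prof, s.cands, s.stk)

instance : Enc St := ⟨fun s => enc s.toProd⟩

/-- Whether the candidate has the attribute `b`. -/
def owns (b : List Bool) (c : CandCode) : Bool :=
  match c.1 with
  | none => false
  | some b' => eqBits b b'

/-- The tables for making a single attribute true or false. -/
def leaf (b : List Bool) (cs : List CandCode) : Tab × Tab :=
  (none :: (prodTab ((cs.filter (owns b)).map Prod.snd)).tail, [some ([], [])])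

/-- The tables of a conjunction. -/
def conTab (x y : Tab × Tab) : Tab × Tab :=
  (mul x.1 y.1, pmax (mul x.2 (pmax y.1 y.2)) (mul x.1 y.2))

/-- The tables of a disjunction. -/
def disTab (x y : Tab × Tab) : Tab × Tab := (conTab x.swap y.swap).swap

/-- The tables of an implication. -/
def impTab (x y : Tab × Tab) : Tab × Tab := (conTab x y.swap).swap

/-- Apply a connective to the topmost entries. -/
def apply₂ (f : Tab × Tab → Tab × Tab → Tab × Tab) : List (Tab × Tab) → List (Tab × Tab)
  | [] => []
  | x :: t => match t with
    | [] => []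
    | y :: t => f x y :: t

/-- The decision procedure reads a symbol. -/
def step (s : St) (x : Sym) : St :=
  match x with
  | .bit b => { s with bits := b :: s.bits }
  | .fin => { s with bits := [], nums := s.bits :: s.nums }
  | .plus => { s with prof := (s.bits, []) }
  | .minus => { s with prof := ([], s.bits) }
  | .attr => { s with attr := some s.bits }
  | .cand => { s with attr := none, cands := (s.attr, s.prof) :: s.cands }
  | .pos => { s with
      cands := s.cands.filter fun c => !owns s.bits c
      stk := leaf s.bits s.cands :: s.stk }
  | .neg => { s with
      cands := s.cands.filter fun c => !owns s.bits c
      stk := (leaf s.bits s.cands).swap :: s.stk }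
  | .and => { s with stk := apply₂ conTab s.stk }
  | .or => { s with stk := apply₂ disTab s.stk }
  | .imp => { s with stk := apply₂ conTab (apply₂ impTab s.stk) }

/-- The initial state. -/
def St.init : St := ⟨[], [], none, ([], []), [], [([some ([], [])], [])]⟩

/-- Whether an entry of a table is at least `p`. -/
def geNum (p : List Bool) (o : Option Num) : Bool :=
  match o with
  | none => false
  | some n => leNum (p, []) n

/-- Read an entry of a table; the state consists of its position and the answer so far. -/
def checkStep (k p : List Bool) (s : List Bool × Bool) (o : Option Num) : List Bool × Bool :=
  (addBits [true] s.1, s.2 || (eqBits s.1 k && geNum p o))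

/-- Whether the entry of a table at `k` is at least `p`. -/
def check (t : Tab) (k p : List Bool) : Bool := (t.foldl (checkStep k p) ([], false)).2

/-- The answer, when the input has been read. -/
def answer (s : St) : Bool :=
  check (mul (s.stk.head?.getD ([], [])).1 (prodTab (s.cands.map Prod.snd)))
    (s.nums.head?.getD []) (s.nums.tail.head?.getD [])

/-! ### The decision procedure consists of polynomial-time steps -/

namespace PT

variable {α β : Type} [Enc α] [Enc β]

@[fun_prop]
theorem tail {l : α → List β} (hl : PT l) : PT fun a => (l a).tail :=
  (listCases hl (const []) (g := fun p => p.2.2) (by fun_prop)).of_eq fun a => by cases l a <;> rfl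

@[fun_prop]
theorem head? {l : α → List β} (hl : PT l) : PT fun a => (l a).head? :=
  (listCases hl (const none) (g := fun p => some p.2.1) (by fun_prop)).of_eq fun a => by
    cases l a <;> rfl

@[fun_prop]
theorem swap {γ : Type} [Enc γ] {f : α → β × γ} (hf : PT f) : PT fun a => (f a).swap :=
  hf.snd.prodMk hf.fst

theorem toProd {f : α → St} (hf : PT f) : PT fun a => (f a).toProd := hf.of_enc fun _ => rfl

@[fun_prop]
theorem bits {f : α → St} (hf : PT f) : PT fun a => (f a).bits := hf.toProd.fst

@[fun_prop]
theorem nums {f : α → St} (hf : PT f) : PT fun a => (f a).nums := hf.toProd.snd.fst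

@[fun_prop]
theorem attr {f : α → St} (hf : PT f) : PT fun a => (f a).attr := hf.toProd.snd.snd.fst

@[fun_prop]
theorem prof {f : α → St} (hf : PT f) : PT fun a => (f a).prof := hf.toProd.snd.snd.snd.fst

@[fun_prop]
theorem cands {f : α → St} (hf : PT f) : PT fun a => (f a).cands := hf.toProd.snd.snd.snd.snd.fst

@[fun_prop]
theorem stk {f : α → St} (hf : PT f) : PT fun a => (f a).stk := hf.toProd.snd.snd.snd.snd.snd

@[fun_prop]
theorem mk {f₁ : α → List Bool} {f₂ : α → List (List Bool)} {f₃ : α → Option (List Bool)}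
    {f₄ : α → Num} {f₅ : α → List CandCode} {f₆ : α → List (Tab × Tab)} (h₁ : PT f₁) (h₂ : PT f₂)
    (h₃ : PT f₃) (h₄ : PT f₄) (h₅ : PT f₅) (h₆ : PT f₆) :
    PT fun a => St.mk (f₁ a) (f₂ a) (f₃ a) (f₄ a) (f₅ a) (f₆ a) :=
  (h₁.prodMk (h₂.prodMk (h₃.prodMk (h₄.prodMk (h₅.prodMk h₆))))).of_enc fun _ => rfl

@[fun_prop]
theorem owns {b : α → List Bool} {c : α → CandCode} (hb : PT b) (hc : PT c) :
    PT fun a => owns (b a) (c a) :=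
  (optionCases (l := fun a => (c a).1) (e := fun _ => false)
    (g := fun p => CECAC.eqBits (b p.1) p.2) (by fun_prop) (by fun_prop) (by fun_prop)).of_eq
    fun a => by simp only [CECAC.owns]; cases (c a).1 <;> rfl

@[fun_prop]
theorem leaf {b : α → List Bool} {cs : α → List CandCode} (hb : PT b) (hcs : PT cs) :
    PT fun a => leaf (b a) (cs a) := by
  have h1 : PT fun a => (cs a).filter (CECAC.owns (b a)) := filter hcs (by fun_prop)
  have h2 := map h1 (f := fun _ => Prod.snd) (by fun_prop)
  unfold CECAC.leaf
  fun_prop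

theorem others {b : α → List Bool} {cs : α → List CandCode} (hb : PT b) (hcs : PT cs) :
    PT fun a => (cs a).filter fun c => !CECAC.owns (b a) c :=
  filter hcs (f := fun a c => !CECAC.owns (b a) c) (by fun_prop)

@[fun_prop]
theorem conTab {x y : α → Tab × Tab} (hx : PT x) (hy : PT y) : PT fun a => conTab (x a) (y a) := by
  unfold CECAC.conTab
  fun_prop

@[fun_prop]
theorem disTab {x y : α → Tab × Tab} (hx : PT x) (hy : PT y) : PT fun a => disTab (x a) (y a) := by
  unfold CECAC.disTab
  fun_prop

@[fun_prop]
theorem impTab {x y : α → Tab × Tab} (hx : PT x) (hy : PT y) : PT fun a => impTab (x a) (y a) := by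
  unfold CECAC.impTab
  fun_prop

theorem apply₂ {f : Tab × Tab → Tab × Tab → Tab × Tab} (hf : PT fun p : (Tab × Tab) × (Tab × Tab) =>
    f p.1 p.2) {l : α → List (Tab × Tab)} (hl : PT l) : PT fun a => apply₂ f (l a) :=
  (listCases hl (const []) (listCases
    (l := fun p : α × (Tab × Tab) × List (Tab × Tab) => p.2.2) (e := fun _ => [])
    (g := fun q => f q.1.2.1 q.2.1 :: q.2.2) (by fun_prop) (by fun_prop)
    (cons (hf.comp (f := fun q : (α × (Tab × Tab) × List (Tab × Tab)) × (Tab × Tab) ×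
      List (Tab × Tab) => (q.1.2.1, q.2.1)) (by fun_prop)) (by fun_prop)))).of_eq fun a => by
        rcases l a with _ | ⟨x, _ | ⟨y, t⟩⟩ <;> rfl

theorem step : PT fun p : St × Sym => step p.1 p.2 := by
  refine finCases (σ := Sym) (f := fun p : St × Sym => p.2) (g := fun x p => CECAC.step p.1 x)
    [.bit false, .bit true, .fin, .plus, .minus, .pos, .neg, .and, .or, .imp, .cand, .attr] ?_
    enc_sym_injective (by fun_prop) ?_
  · intro x
    cases x with
    | bit b => cases b <;> simp
    | _ => simp
  · intro x
    have h1 : PT fun p : St × Sym => p.1.cands.filter fun c => !CECAC.owns p.1.bits c :=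
      others (by fun_prop) (by fun_prop)
    have h2 : PT fun p : St × Sym => CECAC.apply₂ CECAC.conTab p.1.stk :=
      apply₂ (by fun_prop) (by fun_prop)
    have h3 : PT fun p : St × Sym => CECAC.apply₂ CECAC.disTab p.1.stk :=
      apply₂ (by fun_prop) (by fun_prop)
    have h4 : PT fun p : St × Sym => CECAC.apply₂ CECAC.conTab
        (CECAC.apply₂ CECAC.impTab p.1.stk) :=
      apply₂ (by fun_prop) (apply₂ (by fun_prop) (by fun_prop))
    cases x <;> simp only [CECAC.step] <;> fun_prop

@[fun_prop]
theorem geNum {p : α → List Bool} {o : α → Option Num} (hp : PT p) (ho : PT o) :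
    PT fun a => geNum (p a) (o a) :=
  (optionCases (l := o) (e := fun _ => false)
    (g := fun q => CECAC.leNum (p q.1, []) q.2) (by fun_prop) (by fun_prop) (by fun_prop)).of_eq
    fun a => by simp only [CECAC.geNum]; cases o a <;> rfl

@[fun_prop]
theorem check {t : α → Tab} {k p : α → List Bool} (ht : PT t) (hk : PT k) (hp : PT p) :
    PT fun a => check (t a) (k a) (p a) := by
  obtain ⟨L, hL⟩ := ht.esize_le
  refine snd (foldl_of_le (i := fun _ => (([], false) : List Bool × Bool))
    (f := fun a => checkStep (k a) (p a)) ht (const _) (by unfold checkStep; fun_prop)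
    (4 * (L + 1) + 5) ?_)
  intro a l₁ l₂ h
  -- The position counter gains at most one digit per entry; this crude bound suffices.
  have key : ∀ (l : Tab) (s : List Bool × Bool),
      (l.foldl (checkStep (k a) (p a)) s).1.length ≤ max 1 s.1.length + l.length := by
    intro l
    induction l with
    | nil => simp
    | cons o l ih =>
      intro s
      have h1 := ih (checkStep (k a) (p a) s o)
      have h2 := length_addBits_le [true] s.1
      rw [List.foldl_cons, List.length_cons]
      simp only [List.length_singleton] at h2
      have h3 : (checkStep (k a) (p a) s o).1 = CECAC.addBits [true] s.1 := rfl
      rw [h3] at h1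
      omega
  have h1 := key l₁ ([], false)
  have h2 := length_le_esize (t a)
  have h3 := hL a
  rw [h, List.length_append] at h2
  generalize l₁.foldl (checkStep (k a) (p a)) ([], false) = r at h1
  rcases r with ⟨c, r⟩
  have h4 := esize_bits_le c
  have h5 := esize_bool_le r
  have h6 := esize_prod c r
  rw [h] at h3
  simp only [Polynomial.eval_add, Polynomial.eval_mul, Polynomial.eval_one,
    Polynomial.eval_ofNat, List.length_nil] at h1 ⊢
  omega

theorem answer : PT CECAC.answer := by
  have h1 : PT fun s : St => s.cands.map Prod.snd :=
    map (f := fun _ => Prod.snd) (by fun_prop) (by fun_prop)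
  have h2 : PT fun s : St => CECAC.answer s := by
    unfold CECAC.answer
    fun_prop
  exact h2

end PT

/-! ### The size of the states -/

/-- Both tables have at most `L` entries with at most `W` digits. -/
def PairBdd (W L : ℕ) (x : Tab × Tab) : Prop := TabBdd L W x.1 ∧ TabBdd L W x.2

theorem PairBdd.mono {L L' W W' : ℕ} {x : Tab × Tab} (h : PairBdd W L x) (hW : W ≤ W')
    (hL : L ≤ L') : PairBdd W' L' x := ⟨h.1.mono hL hW, h.2.mono hL hW⟩

theorem PairBdd.swap {L W : ℕ} {x : Tab × Tab} (h : PairBdd W L x) : PairBdd W L x.swap :=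
  ⟨h.2, h.1⟩

/-- The products are not nested and maxima cost nothing, so one extra digit is enough. -/
theorem PairBdd.conTab {L L' W : ℕ} {x y : Tab × Tab} (hx : PairBdd W L x) (hy : PairBdd W L' y) :
    PairBdd (W + 1) (L + L') (conTab x y) := by
  refine ⟨hx.1.mul hy.1, ?_⟩
  refine ((hx.2.mul (hy.1.pmax hy.2)).pmax (hx.1.mul hy.2)).mono ?_ le_rfl
  simp

theorem PairBdd.disTab {L L' W : ℕ} {x y : Tab × Tab} (hx : PairBdd W L x) (hy : PairBdd W L' y) :
    PairBdd (W + 1) (L + L') (disTab x y) := (hx.swap.conTab hy.swap).swap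

theorem PairBdd.impTab {L L' W : ℕ} {x y : Tab × Tab} (hx : PairBdd W L x) (hy : PairBdd W L' y) :
    PairBdd (W + 1) (L + L') (impTab x y) := (hx.conTab hy.swap).swap

/-- The candidate's data have at most `W` digits. -/
def CandBdd (W : ℕ) (c : CandCode) : Prop := (∀ b, c.1 = some b → b.length ≤ W) ∧ NumBdd W c.2

theorem pairBdd_leaf {W : ℕ} {cs : List CandCode} (h : ∀ c ∈ cs, CandBdd W c) (b : List Bool) :
    PairBdd (W + cs.length) (2 * (cs.filter (owns b)).length + 1) (leaf b cs) := by
  have h1 := tabBdd_prodTab (W := W) ((cs.filter (owns b)).map Prod.snd) (by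
    intro n hn
    obtain ⟨c, hc, rfl⟩ := List.mem_map.1 hn
    exact (h c (List.mem_of_mem_filter hc)).2)
  have h2 : (cs.filter (owns b)).length ≤ cs.length := List.length_filter_le _ _
  rw [List.length_map] at h1
  have h3 : TabBdd (2 * (cs.filter (owns b)).length) (W + cs.length)
      (prodTab ((cs.filter (owns b)).map Prod.snd)).tail := by
    refine ⟨?_, fun n hn => ((h1.2 n (List.mem_of_mem_tail hn)).mono (by omega))⟩
    have := h1.1
    rw [List.length_tail]
    omega
  exact ⟨h3.cons (by simp), (tabBdd_one _).mono (by omega) le_rfl⟩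

/-- Bounds for the tables on the stack. -/
def StkBdd (W L : ℕ) (l : List (Tab × Tab)) : Prop :=
  ∃ ks : List ℕ, List.Forall₂ (PairBdd W) ks l ∧ ks.sum + ks.length ≤ L

theorem StkBdd.mono {W W' L L' : ℕ} {l : List (Tab × Tab)} (h : StkBdd W L l) (hW : W ≤ W')
    (hL : L ≤ L') : StkBdd W' L' l := by
  obtain ⟨ks, h1, h2⟩ := h
  exact ⟨ks, h1.imp fun _ _ h => h.mono hW le_rfl, h2.trans hL⟩

theorem StkBdd.cons {W L k : ℕ} {l : List (Tab × Tab)} {x : Tab × Tab} (h : StkBdd W L l)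
    (hx : PairBdd W k x) : StkBdd W (L + k + 1) (x :: l) := by
  obtain ⟨ks, h1, h2⟩ := h
  refine ⟨k :: ks, .cons hx h1, ?_⟩
  simp only [List.sum_cons, List.length_cons]
  omega

/-- Two entries are replaced by one whose length bound is the sum of theirs, so the total does not
increase. -/
theorem StkBdd.apply₂ {W L : ℕ} {l : List (Tab × Tab)} {f : Tab × Tab → Tab × Tab → Tab × Tab}
    (hf : ∀ x y k k', PairBdd W k x → PairBdd W k' y → PairBdd (W + 1) (k + k') (f x y))
    (h : StkBdd W L l) : StkBdd (W + 1) L (apply₂ f l) := by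
  obtain ⟨ks, h1, h2⟩ := h
  rcases h1 with _ | ⟨hx, h1⟩
  · exact ⟨[], .nil, by simp⟩
  · rcases h1 with _ | ⟨hy, h1⟩
    · exact ⟨[], .nil, by simp⟩
    · refine ⟨_, .cons (hf _ _ _ _ hx hy) (h1.imp fun _ _ h => h.mono (by omega) le_rfl), ?_⟩
      simp only [List.sum_cons, List.length_cons] at h2 ⊢
      omega

/-- Bounds for the lengths and the numbers of digits in a state. -/
structure St.Bdd (W L : ℕ) (s : St) : Prop where
  bits : s.bits.length ≤ W
  nums_length : s.nums.length ≤ L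
  nums : ∀ b ∈ s.nums, b.length ≤ W
  attr : ∀ b, s.attr = some b → b.length ≤ W
  prof : NumBdd W s.prof
  cands : ∀ c ∈ s.cands, CandBdd W c
  cands_length : 2 * s.cands.length ≤ L
  stk : StkBdd W (L - 2 * s.cands.length) s.stk

theorem CandBdd.mono {W W' : ℕ} {c : CandCode} (h : CandBdd W c) (hW : W ≤ W') : CandBdd W' c :=
  ⟨fun b hb => (h.1 b hb).trans hW, h.2.mono hW⟩

theorem St.Bdd.mono {W W' L L' : ℕ} {s : St} (h : s.Bdd W L) (hW : W ≤ W') (hL : L ≤ L') :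
    s.Bdd W' L' where
  bits := h.bits.trans hW
  nums_length := h.nums_length.trans hL
  nums := fun b hb => (h.nums b hb).trans hW
  attr := fun b hb => (h.attr b hb).trans hW
  prof := h.prof.mono hW
  cands := fun c hc => (h.cands c hc).mono hW
  cands_length := h.cands_length.trans hL
  stk := h.stk.mono hW (by omega)

/-- `L` acts as a potential: two units for each waiting candidate, one for each table pair, and the
length bounds of the pairs. A literal moves the units of its owners into the length of the new
tables, so a symbol adds at most four. The digit bound grows by at most the number of waiting
candidates at a literal, and by two at an implication. Malformed words are covered as well, since
`PT` asks for a time bound on all inputs. -/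
theorem St.Bdd.step {W L : ℕ} {s : St} (h : s.Bdd W L) (x : Sym) :
    (step s x).Bdd (W + L + 2) (L + 4) := by
  have h' : s.Bdd (W + L + 2) (L + 4) := h.mono (by omega) (by omega)
  have hleaf : PairBdd (W + L + 2) (2 * (s.cands.filter (owns s.bits)).length + 1)
      (leaf s.bits s.cands) :=
    (pairBdd_leaf h.cands s.bits).mono (by have := h.cands_length; omega) le_rfl
  have hlen : (s.cands.filter (owns s.bits)).length +
      (s.cands.filter fun c => !owns s.bits c).length = s.cands.length := by
    rw [← List.length_eq_length_filter_add]
  have hfil : ∀ c ∈ s.cands.filter (fun c => !owns s.bits c), CandBdd (W + L + 2) c :=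
    fun c hc => h'.cands c (List.mem_of_mem_filter hc)
  have hc := h.cands_length
  cases x with
  | bit b => exact { h' with bits := by simp only [CECAC.step, List.length_cons]; have := h.bits; omega }
  | fin => exact { h' with
      bits := Nat.zero_le _
      nums_length := by simp only [CECAC.step, List.length_cons]; have := h.nums_length; omega
      nums := fun b hb => by
        rcases List.mem_cons.1 hb with rfl | hb
        · exact h'.bits
        · exact h'.nums b hb }
  | plus => exact { h' with prof := ⟨h'.bits, Nat.zero_le _⟩ }
  | minus => exact { h' with prof := ⟨Nat.zero_le _, h'.bits⟩ }
  | attr => exact { h' with attr := fun b hb => (Option.some.inj hb) ▸ h'.bits }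
  | cand => exact { h' with
      attr := by simp [CECAC.step]
      cands := fun c hc => by
        rcases List.mem_cons.1 hc with rfl | hc
        · exact ⟨h'.attr, h'.prof⟩
        · exact h'.cands c hc
      cands_length := by simp only [CECAC.step, List.length_cons]; omega
      stk := h.stk.mono (by omega) (by simp only [CECAC.step, List.length_cons]; omega) }
  | pos => exact { h' with
      cands := hfil
      cands_length := by simp only [CECAC.step]; omega
      stk := ((h.stk.mono (W' := W + L + 2) (by omega) le_rfl).cons hleaf).mono le_rfl
        (by simp only [CECAC.step]; omega) }
  | neg => exact { h' with
      cands := hfil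
      cands_length := by simp only [CECAC.step]; omega
      stk := ((h.stk.mono (W' := W + L + 2) (by omega) le_rfl).cons hleaf.swap).mono le_rfl
        (by simp only [CECAC.step]; omega) }
  | and => exact { h' with
      stk := (h.stk.apply₂ fun _ _ _ _ hx hy => hx.conTab hy).mono (by omega)
        (by simp only [CECAC.step]; omega) }
  | or => exact { h' with
      stk := (h.stk.apply₂ fun _ _ _ _ hx hy => hx.disTab hy).mono (by omega)
        (by simp only [CECAC.step]; omega) }
  | imp => exact { h' with
      stk := ((h.stk.apply₂ fun _ _ _ _ hx hy => hx.impTab hy).apply₂ fun _ _ _ _ hx hy =>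
        hx.conTab hy).mono (by omega) (by simp only [CECAC.step]; omega) }

/-- The length bound is linear throughout, and each symbol adds at most the final length bound plus
two to the digit bound. -/
theorem bdd_foldl_step (w : List Sym) :
    (w.foldl step .init).Bdd (w.length * (4 * w.length + 4)) (4 * w.length + 2) := by
  have key : ∀ (w : List Sym) (W L : ℕ) (s : St), s.Bdd W L →
      (w.foldl step s).Bdd (W + w.length * (L + 4 * w.length + 2)) (L + 4 * w.length) := by
    intro w
    induction w with
    | nil => exact fun W L s h => h.mono (by simp) (by simp)
    | cons x w ih =>
      intro W L s h
      refine (ih _ _ _ (h.step x)).mono ?_ ?_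
      · rw [List.length_cons]
        nlinarith
      · rw [List.length_cons]
        omega
  -- The initial pair on the stack has length bound one and counts as one pair, hence 2.
  have h0 : St.init.Bdd 0 2 :=
    { bits := le_rfl
      nums_length := Nat.zero_le _
      nums := by simp [St.init]
      attr := by simp [St.init]
      prof := ⟨le_rfl, le_rfl⟩
      cands := by simp [St.init]
      cands_length := Nat.zero_le _
      stk := ⟨[1], .cons ⟨tabBdd_one 0, ⟨Nat.zero_le _, by simp⟩⟩ .nil, by simp [St.init]⟩ }
  refine (key w 0 2 _ h0).mono (le_of_eq ?_) (by omega)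
  ring

theorem StkBdd.esize_le {W L : ℕ} {l : List (Tab × Tab)} (h : StkBdd W L l) :
    esize l ≤ L * (2 * (L * (8 * W + 6) + 1) + 2) + 1 := by
  obtain ⟨ks, h1, h2⟩ := h
  have h3 : ∀ x ∈ l, esize x ≤ 2 * (L * (8 * W + 6) + 1) + 1 := by
    intro x hx
    obtain ⟨i, hi, rfl⟩ := List.getElem_of_mem hx
    have h4 := (List.forall₂_iff_get.1 h1).2 i (by rw [h1.length_eq]; exact hi) hi
    have h5 : ks.get ⟨i, by rw [h1.length_eq]; exact hi⟩ ≤ L :=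
      (List.le_sum_of_mem (List.get_mem _ _)).trans (by omega)
    have h6 := (h4.mono le_rfl h5).1.esize_le
    have h7 := (h4.mono le_rfl h5).2.esize_le
    have h8 := esize_prod (l.get ⟨i, hi⟩).1 (l.get ⟨i, hi⟩).2
    simp only [List.get_eq_getElem, Prod.mk.eta] at *
    omega
  refine (esize_list_le l h3).trans ?_
  have h4 : l.length ≤ L := by rw [← h1.length_eq]; omega
  exact Nat.add_le_add_right (Nat.mul_le_mul_right _ h4) _

theorem St.Bdd.esize_le {W L : ℕ} {s : St} (h : s.Bdd W L) :
    esize s ≤ (4 * W + 1) + (L * (4 * W + 2) + 1) + (4 * W + 3) + (8 * W + 3) +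
      (L * (12 * W + 8) + 1) + (L * (2 * (L * (8 * W + 6) + 1) + 2) + 1) + 5 := by
  have e0 : esize s = esize s.bits + (esize s.nums + (esize s.attr + (esize s.prof +
      (esize s.cands + esize s.stk + 1) + 1) + 1) + 1) + 1 := by
    rw [← esize_prod, ← esize_prod, ← esize_prod, ← esize_prod, ← esize_prod]
    rfl
  have e1 := (esize_bits_le s.bits).trans
    (Nat.add_le_add_right (Nat.mul_le_mul_left 4 h.bits) 1)
  have eo : ∀ o : Option (List Bool), (∀ b, o = some b → b.length ≤ W) → esize o ≤ 4 * W + 3 := by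
    rintro (_ | b) hb
    · rw [esize_none]
      omega
    · have h1 := esize_bits_le b
      have h2 := hb b rfl
      rw [esize_some]
      omega
  have e2 : esize s.nums ≤ L * (4 * W + 2) + 1 := by
    refine (esize_list_le (B := 4 * W + 1) s.nums fun b hb => (esize_bits_le b).trans
      (Nat.add_le_add_right (Nat.mul_le_mul_left 4 (h.nums b hb)) 1)).trans ?_
    exact Nat.add_le_add_right (Nat.mul_le_mul_right _ h.nums_length) _
  have e3 := eo s.attr h.attr
  have e4 := h.prof.esize_le
  have e5 : esize s.cands ≤ L * (12 * W + 8) + 1 := by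
    refine (esize_list_le (B := 12 * W + 7) s.cands fun c hc => ?_).trans ?_
    · have h1 := eo c.1 (h.cands c hc).1
      have h2 := (h.cands c hc).2.esize_le
      have h3 : esize c = esize c.1 + esize c.2 + 1 := esize_prod c.1 c.2
      omega
    · have := h.cands_length
      exact Nat.add_le_add_right (Nat.mul_le_mul_right _ (by omega)) _
  have e6 := (h.stk.mono le_rfl (Nat.sub_le _ _)).esize_le
  omega

/-- The decision procedure, on the input read backwards, runs in polynomial time. -/
theorem PT.decide_word : PT fun w : List Sym => CECAC.answer (w.foldl CECAC.step .init) := by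
  let L : Polynomial ℕ := 4 * .X + 2
  let W : Polynomial ℕ := .X * (4 * .X + 4)
  refine PT.comp (f := fun w : List Sym => w.foldl CECAC.step .init) PT.answer
    (foldl_of_le (l := fun w => w) (i := fun _ => St.init) (f := fun _ => CECAC.step) PT.id
    (const _) (PT.step.comp (f := fun p : List Sym × St × Sym => p.2) (by fun_prop))
    ((4 * W + 1) + (L * (4 * W + 2) + 1) + (4 * W + 3) + (8 * W + 3) +
      (L * (12 * W + 8) + 1) + (L * (2 * (L * (8 * W + 6) + 1) + 2) + 1) + 5) ?_)
  intro w l₁ l₂ h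
  have h1 : l₁.length ≤ esize w := by
    refine le_trans ?_ (length_le_esize w)
    rw [h, List.length_append]
    omega
  have h2 := ((bdd_foldl_step l₁).mono (W' := esize w * (4 * esize w + 4))
    (L' := 4 * esize w + 2) (Nat.mul_le_mul h1 (by omega)) (by omega)).esize_le
  simpa [L, W] using h2

/-! ### Correctness of the decision procedure -/

theorem foldl_checkStep_iff (t : Tab) (k p : List Bool) : ∀ s : List Bool × Bool,
    (t.foldl (checkStep k p) s).2 = true ↔
      s.2 = true ∨ ∃ i, val s.1 + i = val k ∧ Sat t i (val p) := by
  induction t with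
  | nil => simp [sat_nil]
  | cons o t ih =>
    intro s
    have h1 : val (checkStep k p s o).1 = val s.1 + 1 := by
      simp only [checkStep, val_addBits, val]
      simp
      omega
    have h2 : geNum p o = true ↔ Sat (o :: t) 0 (val p) := by
      rw [sat_cons_zero]
      cases o with
      | none => simp [geNum]
      | some n => simp [geNum, leNum_iff, ival, val]
    have h3 : (checkStep k p s o).2 = true ↔
        s.2 = true ∨ (val s.1 = val k ∧ Sat (o :: t) 0 (val p)) := by
      simp only [checkStep, Bool.or_eq_true, Bool.and_eq_true, eqBits_iff, h2]
    rw [List.foldl_cons, ih, h1, h3]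
    constructor
    · rintro ((h | h) | ⟨i, hi, h⟩)
      · exact Or.inl h
      · exact Or.inr ⟨0, by omega, h.2⟩
      · exact Or.inr ⟨i + 1, by omega, (sat_cons_succ _ _ _ _).2 h⟩
    · rintro (h | ⟨i, hi, h⟩)
      · exact Or.inl (Or.inl h)
      · rcases i with _ | i
        · exact Or.inl (Or.inr ⟨by omega, h⟩)
        · exact Or.inr ⟨i, by omega, (sat_cons_succ _ _ _ _).1 h⟩

theorem check_iff (t : Tab) (k p : List Bool) :
    check t k p = true ↔ Sat t (val k) (val p) := by
  rw [check, foldl_checkStep_iff]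
  simp [val]

/-- The code of an integer. -/
def numOf (z : ℤ) : Num :=
  if 0 ≤ z then (Computability.encodeNat z.natAbs, []) else ([], Computability.encodeNat z.natAbs)

theorem ival_numOf (z : ℤ) : ival (numOf z) = z := by
  unfold numOf ival
  split_ifs <;> simp only [val, val_encodeNat] <;> omega

/-- The effect of reading a word backwards. -/
def run (w : List Sym) (s : St) : St := w.foldr (fun x s => step s x) s

theorem run_append (w w' : List Sym) (s : St) : run (w ++ w') s = run w (run w' s) :=
  List.foldr_append

theorem run_cons (x : Sym) (w : List Sym) (s : St) : run (x :: w) s = step (run w s) x := rfl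

theorem run_encNat (n : ℕ) (s : St) : run (encNat n) s =
    { s with bits := Computability.encodeNat n, nums := s.bits :: s.nums } := by
  have key : ∀ (l : List Bool) (s : St), run (l.map Sym.bit) s = { s with bits := l ++ s.bits } := by
    intro l
    induction l with
    | nil => exact fun s => rfl
    | cons b l ih =>
      intro s
      rw [List.map_cons, run_cons, ih]
      rfl
  rw [encNat, run_append, key]
  simp [run, step]

theorem run_encInt (z : ℤ) (s : St) : run (encInt z) s =
    { s with
      bits := Computability.encodeNat z.natAbs
      nums := s.bits :: s.nums
      prof := numOf z } := by
  rw [encInt, run_cons, run_encNat]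
  split_ifs with h <;> simp [step, numOf, h]

/-! ### Tables as best profits of families of committees -/

namespace Instance

variable (I : Instance)

/-- The table lists, for each size, the best profit of the subsets of `Z` with the property `P`. -/
def Rep (t : Tab) (Z : Finset (Fin I.m)) (P : Finset (Fin I.m) → Prop) : Prop :=
  ∀ j v, Sat t j v ↔ ∃ W ⊆ Z, P W ∧ W.card = j ∧ v ≤ ∑ c ∈ W, I.S c

/-- Tables for a property and its negation. -/
def RepPair (x : Tab × Tab) (Z : Finset (Fin I.m)) (P : Finset (Fin I.m) → Prop) : Prop :=
  I.Rep x.1 Z P ∧ I.Rep x.2 Z fun W => ¬ P W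

variable {I}

theorem Rep.congr {t : Tab} {Z : Finset (Fin I.m)} {P Q : Finset (Fin I.m) → Prop}
    (h : I.Rep t Z P) (hPQ : ∀ W ⊆ Z, P W ↔ Q W) : I.Rep t Z Q := by
  intro j v
  rw [h j v]
  exact exists_congr fun W => and_congr_right fun hW => and_congr_left' (hPQ W hW)

theorem RepPair.congr {x : Tab × Tab} {Z : Finset (Fin I.m)} {P Q : Finset (Fin I.m) → Prop}
    (h : I.RepPair x Z P) (hPQ : ∀ W ⊆ Z, P W ↔ Q W) : I.RepPair x Z Q :=
  ⟨h.1.congr hPQ, h.2.congr fun W hW => not_congr (hPQ W hW)⟩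

theorem Rep.pmax {s t : Tab} {Z : Finset (Fin I.m)} {P Q : Finset (Fin I.m) → Prop}
    (hs : I.Rep s Z P) (ht : I.Rep t Z Q) : I.Rep (pmax s t) Z fun W => P W ∨ Q W := by
  intro j v
  rw [sat_pmax, hs j v, ht j v, ← exists_or]
  refine exists_congr fun W => ?_
  tauto

/-- By disjointness, subsets of `Y ∪ Z` correspond to pairs of a subset of `Y` and one of `Z`, with
sizes and profits adding up. This is the independence that the method rests on. -/
theorem Rep.mul {s t : Tab} {Y Z : Finset (Fin I.m)} {P Q : Finset (Fin I.m) → Prop}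
    (hs : I.Rep s Y P) (ht : I.Rep t Z Q) (hd : Disjoint Y Z) :
    I.Rep (mul s t) (Y ∪ Z) fun W => P (W ∩ Y) ∧ Q (W ∩ Z) := by
  intro j v
  rw [sat_mul]
  constructor
  · rintro ⟨i, i', u, u', hi, h, h', hv⟩
    obtain ⟨A, hA, hPA, hAi, hu⟩ := (hs i u).1 h
    obtain ⟨B, hB, hQB, hBi, hu'⟩ := (ht i' u').1 h'
    have hAB : Disjoint A B := hd.mono hA hB
    have e1 : (A ∪ B) ∩ Y = A := by
      rw [Finset.union_inter_distrib_right, Finset.inter_eq_left.2 hA,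
        Finset.disjoint_iff_inter_eq_empty.1 (hd.symm.mono_left hB), Finset.union_empty]
    have e2 : (A ∪ B) ∩ Z = B := by
      rw [Finset.union_inter_distrib_right, Finset.inter_eq_left.2 hB,
        Finset.disjoint_iff_inter_eq_empty.1 (hd.mono_left hA), Finset.empty_union]
    refine ⟨A ∪ B, Finset.union_subset_union hA hB, ⟨by rwa [e1], by rwa [e2]⟩, ?_, ?_⟩
    · rw [Finset.card_union_of_disjoint hAB]
      omega
    · rw [Finset.sum_union hAB]
      omega
  · rintro ⟨W, hW, ⟨hP, hQ⟩, hj, hv⟩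
    have e : W = W ∩ Y ∪ W ∩ Z := by
      rw [← Finset.inter_union_distrib_left, Finset.inter_eq_left.2 hW]
    have hd' : Disjoint (W ∩ Y) (W ∩ Z) :=
      hd.mono Finset.inter_subset_right Finset.inter_subset_right
    refine ⟨_, _, _, _, ?_, (hs _ _).2 ⟨W ∩ Y, Finset.inter_subset_right, hP, rfl, le_rfl⟩,
      (ht _ _).2 ⟨W ∩ Z, Finset.inter_subset_right, hQ, rfl, le_rfl⟩, ?_⟩
    · rw [← Finset.card_union_of_disjoint hd', ← e, hj]
    · rwa [← Finset.sum_union hd', ← e]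

theorem RepPair.swap {x : Tab × Tab} {Z : Finset (Fin I.m)} {P : Finset (Fin I.m) → Prop}
    (h : I.RepPair x Z P) : I.RepPair x.swap Z fun W => ¬ P W :=
  ⟨h.2, h.1.congr fun _ _ => not_not.symm⟩

section

variable {x y : Tab × Tab} {Y Z : Finset (Fin I.m)} {P Q : Finset (Fin I.m) → Prop}

/-- A conjunction fails if the left side fails and the right side is arbitrary, or if the left side
holds and the right side fails. -/
theorem RepPair.conTab (hx : I.RepPair x Y P) (hy : I.RepPair y Z Q) (hd : Disjoint Y Z) :
    I.RepPair (conTab x y) (Y ∪ Z) fun W => P (W ∩ Y) ∧ Q (W ∩ Z) := by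
  refine ⟨hx.1.mul hy.1 hd, ((hx.2.mul (hy.1.pmax hy.2) hd).pmax (hx.1.mul hy.2 hd)).congr ?_⟩
  intro W _
  tauto

theorem RepPair.disTab (hx : I.RepPair x Y P) (hy : I.RepPair y Z Q) (hd : Disjoint Y Z) :
    I.RepPair (disTab x y) (Y ∪ Z) fun W => P (W ∩ Y) ∨ Q (W ∩ Z) :=
  (hx.swap.conTab hy.swap hd).swap.congr fun W _ => by tauto

theorem RepPair.impTab (hx : I.RepPair x Y P) (hy : I.RepPair y Z Q) (hd : Disjoint Y Z) :
    I.RepPair (impTab x y) (Y ∪ Z) fun W => P (W ∩ Y) → Q (W ∩ Z) :=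
  (hx.conTab hy.swap hd).swap.congr fun W _ => by tauto

end

theorem rep_one : I.Rep [some ([], [])] ∅ fun _ => True := by
  intro j v
  have : Sat [some ([], [])] j v ↔ j = 0 ∧ v ≤ 0 := by
    rcases j with _ | j
    · simp [sat_cons_zero, ival, val]
    · simp [sat_cons_succ, sat_nil]
  rw [this]
  simp only [Finset.subset_empty, exists_eq_left, Finset.card_empty, Finset.sum_empty, true_and]
  exact and_congr_left' eq_comm

/-- In each factor 1 + sX the first summand leaves the candidate out and the second one takes it. -/
theorem rep_prodTab (cs : List (Fin I.m)) (h : cs.Nodup) :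
    I.Rep (prodTab (cs.map fun c => numOf (I.S c))) cs.toFinset fun _ => True := by
  induction cs with
  | nil => exact rep_one
  | cons c cs ih =>
    have h1 : I.Rep [some ([], []), some (numOf (I.S c))] {c} fun _ => True := by
      intro j v
      simp only [Finset.subset_singleton_iff, or_and_right, exists_or, exists_eq_left, true_and,
        Finset.card_empty, Finset.sum_empty, Finset.card_singleton, Finset.sum_singleton]
      rcases j with _ | _ | j
      · simp [sat_cons_zero, ival, val]
      · simp [sat_cons_succ, sat_cons_zero, ival_numOf]
      · simp [sat_cons_succ, sat_nil]
    have h2 := h1.mul (ih (List.nodup_cons.1 h).2) (by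
      simpa using (List.nodup_cons.1 h).1)
    rw [List.toFinset_cons, Finset.insert_eq]
    exact h2.congr fun _ _ => by simp

variable (I)

/-- The candidates with an attribute in `V`. -/
def owners (V : Finset (Fin I.l)) : Finset (Fin I.m) := Finset.univ.filter fun c => ∃ a ∈ V, a ∈ I.α c

/-- The data of a candidate. -/
def candCode (c : Fin I.m) : CandCode :=
  ((I.α c).sort.head?.map fun a => Computability.encodeNat a, numOf (I.S c))

/-- The data of the candidates without an attribute in `V`. -/
def codes (V : Finset (Fin I.l)) : List CandCode :=
  ((List.finRange I.m).filter fun c => c ∉ I.owners V).map I.candCode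

variable {I}

theorem mem_owners {V : Finset (Fin I.l)} {c : Fin I.m} :
    c ∈ I.owners V ↔ ∃ a ∈ V, a ∈ I.α c := by
  simp [owners]

theorem owners_union (U V : Finset (Fin I.l)) : I.owners (U ∪ V) = I.owners U ∪ I.owners V := by
  ext c
  simp only [mem_owners, Finset.mem_union, or_and_right, exists_or]

/-- A common owner would have two different attributes. -/
theorem disjoint_owners (hα : ∀ c, (I.α c).card ≤ 1) {U V : Finset (Fin I.l)} (h : Disjoint U V) :
    Disjoint (I.owners U) (I.owners V) := by
  rw [Finset.disjoint_left]
  intro c hU hV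
  obtain ⟨a, ha, hac⟩ := mem_owners.1 hU
  obtain ⟨b, hb, hbc⟩ := mem_owners.1 hV
  obtain rfl := Finset.card_le_one.1 (hα c) a hac b hbc
  exact Finset.disjoint_left.1 h ha hb

theorem eq_empty_or_eq_singleton {α : Type} {s : Finset α} (h : s.card ≤ 1) :
    s = ∅ ∨ ∃ b, s = {b} := by
  rcases Nat.le_one_iff_eq_zero_or_eq_one.1 h with h | h
  · exact Or.inl (Finset.card_eq_zero.1 h)
  · exact Or.inr (Finset.card_eq_one.1 h)

theorem owns_candCode (hα : ∀ c, (I.α c).card ≤ 1) (a : Fin I.l) (c : Fin I.m) :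
    owns (Computability.encodeNat a) (I.candCode c) = true ↔ a ∈ I.α c := by
  rcases eq_empty_or_eq_singleton (hα c) with h | ⟨b, h⟩
  · simp [candCode, owns, h]
  · simp [candCode, owns, h, eqBits_iff, val_encodeNat, Fin.ext_iff]

theorem filter_not_owns (hα : ∀ c, (I.α c).card ≤ 1) (a : Fin I.l) (V : Finset (Fin I.l)) :
    (I.codes V).filter (fun c => !owns (Computability.encodeNat a) c) = I.codes (V ∪ {a}) := by
  rw [codes, codes, List.filter_map, List.filter_filter]
  congr 1
  refine List.filter_congr fun c _ => ?_
  have h := owns_candCode hα a c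
  rw [Bool.eq_iff_iff]
  simp only [Function.comp_apply, Bool.and_eq_true, Bool.not_eq_true', decide_eq_true_eq,
    owners_union, Finset.mem_union, mem_owners, Finset.mem_singleton, exists_eq_left, ← h,
    Bool.not_eq_true, not_or]
  exact and_comm

/-- The attribute is true exactly when at least one owner is chosen, so the entry for size zero is
erased from the table of all sets of owners. Since `a ∉ V`, no owner of `a` has been removed before:
it has no other attribute. -/
theorem repPair_leaf (hα : ∀ c, (I.α c).card ≤ 1) {a : Fin I.l} {V : Finset (Fin I.l)}
    (ha : a ∉ V) : I.RepPair (leaf (Computability.encodeNat a) (I.codes V)) (I.owners {a})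
      fun W => I.assignment W a := by
  have e1 : ((I.codes V).filter (owns (Computability.encodeNat a))).map Prod.snd =
      ((List.finRange I.m).filter fun c => a ∈ I.α c).map fun c => numOf (I.S c) := by
    rw [codes, List.filter_map, List.map_map, List.filter_filter]
    have : ((List.finRange I.m).filter fun c => (owns (Computability.encodeNat a) ∘ I.candCode) c &&
        decide (c ∉ I.owners V)) = (List.finRange I.m).filter fun c => a ∈ I.α c := by
      refine List.filter_congr fun c _ => ?_
      rw [Bool.eq_iff_iff]
      simp only [Function.comp_apply, Bool.and_eq_true, decide_eq_true_eq, owns_candCode hα]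
      refine ⟨fun h => h.1, fun h => ⟨h, fun h' => ?_⟩⟩
      exact Finset.disjoint_left.1 (disjoint_owners hα (Finset.disjoint_singleton_right.2 ha)) h'
        (mem_owners.2 ⟨a, by simp, h⟩)
    rw [this]
    rfl
  have e2 : ((List.finRange I.m).filter fun c => a ∈ I.α c).toFinset = I.owners {a} := by
    ext c
    simp [mem_owners]
  have h1 := I.rep_prodTab ((List.finRange I.m).filter fun c => a ∈ I.α c)
    ((List.nodup_finRange _).filter _)
  rw [e2, ← e1] at h1
  have h2 : ∀ W ⊆ I.owners {a}, I.assignment W a ↔ W.card ≠ 0 := by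
    intro W hW
    rw [Finset.card_ne_zero]
    constructor
    · rintro ⟨c, hc, -⟩
      exact ⟨c, hc⟩
    · rintro ⟨c, hc⟩
      obtain ⟨b, hb, hbc⟩ := mem_owners.1 (hW hc)
      rw [Finset.mem_singleton] at hb
      exact ⟨c, hc, hb ▸ hbc⟩
  constructor
  · intro j v
    have h3 : ∀ t : Tab, Sat (none :: t.tail) j v ↔ j ≠ 0 ∧ Sat t j v := by
      intro t
      rcases j with _ | j
      · simp [sat_cons_zero]
      · rw [sat_cons_succ]
        rcases t with _ | ⟨o, t⟩
        · simp [sat_nil]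
        · simp [sat_cons_succ]
    rw [leaf, h3, h1 j v]
    constructor
    · rintro ⟨hj, W, hW, -, rfl, hv⟩
      exact ⟨W, hW, (h2 W hW).2 hj, rfl, hv⟩
    · rintro ⟨W, hW, h, rfl, hv⟩
      exact ⟨(h2 W hW).1 h, W, hW, trivial, rfl, hv⟩
  · intro j v
    rw [leaf, I.rep_one j v]
    refine exists_congr fun W => ?_
    constructor
    · rintro ⟨hW, -, h⟩
      obtain rfl := Finset.subset_empty.1 hW
      exact ⟨Finset.empty_subset _, by simp [assignment], h⟩
    · rintro ⟨hW, h, h'⟩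
      change ¬ I.assignment W a at h
      rw [h2 W hW, not_not, Finset.card_eq_zero] at h
      exact ⟨h.le, trivial, h'⟩

/-- The attributes that occur in a formula. -/
def attrs (q : Formula (Fin I.l)) : Finset (Fin I.l) := Finset.univ.filter fun a => 0 < q.occ a

theorem mem_attrs {q : Formula (Fin I.l)} {a : Fin I.l} : a ∈ attrs q ↔ 0 < q.occ a := by
  simp [attrs]

theorem attrs_pos (a : Fin I.l) : attrs (.pos a) = {a} := by
  ext b
  simp only [mem_attrs, Formula.occ, Finset.mem_singleton]
  split_ifs with h <;> simp [h, eq_comm]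

theorem attrs_neg (a : Fin I.l) : attrs (.neg a) = {a} := attrs_pos a

theorem attrs_and (q r : Formula (Fin I.l)) : attrs (.and q r) = attrs q ∪ attrs r := by
  ext b
  simp only [mem_attrs, Formula.occ, Finset.mem_union]
  omega

theorem attrs_or (q r : Formula (Fin I.l)) : attrs (.or q r) = attrs q ∪ attrs r := attrs_and q r

/-- Members outside `Z` own none of the attributes of the formula and cannot affect its truth. -/
theorem holds_inter (q : Formula (Fin I.l)) {Z : Finset (Fin I.m)} (hZ : I.owners (attrs q) ⊆ Z)
    (W : Finset (Fin I.m)) : q.Holds (I.assignment (W ∩ Z)) ↔ q.Holds (I.assignment W) := by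
  have key : ∀ a, I.owners {a} ⊆ Z → (I.assignment (W ∩ Z) a ↔ I.assignment W a) := by
    intro a ha
    refine exists_congr fun c => and_congr_left fun hc => ?_
    rw [Finset.mem_inter, and_iff_left (ha (mem_owners.2 ⟨a, by simp, hc⟩))]
  induction q with
  | pos a => exact key a (by rwa [← attrs_pos])
  | neg a => exact not_congr (key a (by rwa [← attrs_neg]))
  | and q r ihq ihr =>
    rw [attrs_and, owners_union] at hZ
    exact and_congr (ihq (Finset.union_subset_left hZ)) (ihr (Finset.union_subset_right hZ))
  | or q r ihq ihr =>
    rw [attrs_or, owners_union] at hZ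
    exact or_congr (ihq (Finset.union_subset_left hZ)) (ihr (Finset.union_subset_right hZ))

theorem disjoint_attrs {q r : Formula (Fin I.l)} (h : ∀ a, q.occ a + r.occ a ≤ 1) :
    Disjoint (attrs q) (attrs r) := by
  rw [Finset.disjoint_left]
  intro a ha hb
  have := h a
  rw [mem_attrs] at ha hb
  omega

/-- `V` is the set of attributes met so far. Reading backwards, the right operand is evaluated
first, so the left one lies on top when the connective arrives; its attributes are new because no
attribute occurs twice. -/
theorem run_encFormula (hα : ∀ c, (I.α c).card ≤ 1) (q : Formula (Fin I.l)) :
    (∀ a, q.occ a ≤ 1) → ∀ (V : Finset (Fin I.l)) (s : St), Disjoint V (attrs q) →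
      s.cands = I.codes V → ∃ B N x, run (encFormula q) s =
        ⟨B, N, s.attr, s.prof, I.codes (V ∪ attrs q), x :: s.stk⟩ ∧
        I.RepPair x (I.owners (attrs q)) fun W => q.Holds (I.assignment W) := by
  induction q with
  | pos a =>
    intro _ V s hV hs
    rw [attrs_pos] at hV ⊢
    refine ⟨Computability.encodeNat a, s.bits :: s.nums, _, ?_,
      repPair_leaf hα (V := V) (Finset.disjoint_singleton_right.1 hV)⟩
    rw [encFormula, run_cons, run_encNat]
    simp only [step, hs, filter_not_owns hα]
  | neg a =>
    intro _ V s hV hs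
    rw [attrs_neg] at hV ⊢
    refine ⟨Computability.encodeNat a, s.bits :: s.nums, _, ?_,
      (repPair_leaf hα (V := V) (Finset.disjoint_singleton_right.1 hV)).swap⟩
    rw [encFormula, run_cons, run_encNat]
    simp only [step, hs, filter_not_owns hα]
  | and q r ihq ihr =>
    intro hocc V s hV hs
    simp only [Formula.occ] at hocc
    have hd := disjoint_attrs hocc
    rw [attrs_and, Finset.disjoint_union_right] at hV
    obtain ⟨B, N, y, e, hy⟩ := ihr (fun a => (Nat.le_add_left _ _).trans (hocc a)) V s hV.2 hs
    obtain ⟨B', N', x, e', hx⟩ := ihq (fun a => (Nat.le_add_right _ _).trans (hocc a))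
      (V ∪ attrs r) _ (Finset.disjoint_union_left.2 ⟨hV.1, hd.symm⟩)
      (show (run (encFormula r) s).cands = _ by rw [e])
    refine ⟨B', N', conTab x y, ?_, ?_⟩
    · rw [encFormula, run_cons, run_append, e', e, attrs_and, Finset.union_assoc,
        Finset.union_comm (attrs r)]
      rfl
    · rw [attrs_and, owners_union]
      exact (hx.conTab hy (disjoint_owners hα hd)).congr fun W _ =>
        and_congr (holds_inter q subset_rfl W) (holds_inter r subset_rfl W)
  | or q r ihq ihr =>
    intro hocc V s hV hs
    simp only [Formula.occ] at hocc
    have hd := disjoint_attrs hocc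
    rw [attrs_or, Finset.disjoint_union_right] at hV
    obtain ⟨B, N, y, e, hy⟩ := ihr (fun a => (Nat.le_add_left _ _).trans (hocc a)) V s hV.2 hs
    obtain ⟨B', N', x, e', hx⟩ := ihq (fun a => (Nat.le_add_right _ _).trans (hocc a))
      (V ∪ attrs r) _ (Finset.disjoint_union_left.2 ⟨hV.1, hd.symm⟩)
      (show (run (encFormula r) s).cands = _ by rw [e])
    refine ⟨B', N', disTab x y, ?_, ?_⟩
    · rw [encFormula, run_cons, run_append, e', e, attrs_or, Finset.union_assoc,
        Finset.union_comm (attrs r)]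
      rfl
    · rw [attrs_or, owners_union]
      exact (hx.disTab hy (disjoint_owners hα hd)).congr fun W _ =>
        or_congr (holds_inter q subset_rfl W) (holds_inter r subset_rfl W)

/-- The attributes that occur in a list of constraints. -/
def attrsList : List (Constraint (Fin I.l)) → Finset (Fin I.l)
  | [] => ∅
  | r :: R => (attrs r.lhs ∪ attrs r.rhs) ∪ attrsList R

theorem occ_pos_of_mem_attrsList {R : List (Constraint (Fin I.l))} {a : Fin I.l}
    (h : a ∈ attrsList R) : 0 < (R.map (Constraint.occ a)).sum := by
  induction R with
  | nil => simp [attrsList] at h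
  | cons r R ih =>
    simp only [attrsList, Finset.mem_union, mem_attrs] at h
    rw [List.map_cons, List.sum_cons, Constraint.occ]
    rcases h with (h | h) | h
    · omega
    · omega
    · have := ih h
      omega

theorem constraint_holds_inter {R : List (Constraint (Fin I.l))} {r : Constraint (Fin I.l)}
    (h : r ∈ R) (W : Finset (Fin I.m)) :
    r.Holds (I.assignment (W ∩ I.owners (attrsList R))) ↔ r.Holds (I.assignment W) := by
  have hsub : I.owners (attrs r.lhs) ∪ I.owners (attrs r.rhs) ⊆ I.owners (attrsList R) := by
    induction R with
    | nil => simp at h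
    | cons r' R ih =>
      rw [attrsList, owners_union, owners_union]
      rcases List.mem_cons.1 h with rfl | h
      · exact Finset.subset_union_left
      · exact (ih h).trans Finset.subset_union_right
  unfold Constraint.Holds
  rw [holds_inter r.lhs (Finset.union_subset_left hsub) W,
    holds_inter r.rhs (Finset.union_subset_right hsub) W]

/-- The bottom of the stack holds the conjunction of the constraints read so far, starting from the
empty conjunction: true for the empty set, never false. -/
theorem run_constraints (hα : ∀ c, (I.α c).card ≤ 1) (R : List (Constraint (Fin I.l)))
    (hR : ∀ a, (R.map (Constraint.occ a)).sum ≤ 1) (s : St) (hs : s.cands = I.codes ∅)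
    (hs' : s.stk = [([some ([], [])], [])]) : ∃ B N x, run (R.flatMap encConstraint) s =
        ⟨B, N, s.attr, s.prof, I.codes (attrsList R), [x]⟩ ∧
        I.RepPair x (I.owners (attrsList R)) fun W => ∀ r ∈ R, r.Holds (I.assignment W) := by
  induction R with
  | nil =>
    refine ⟨s.bits, s.nums, ([some ([], [])], []), ?_, ?_, ?_⟩
    · rw [attrsList, ← hs, ← hs']
      rfl
    · have : I.owners (attrsList []) = ∅ := by
        ext c
        simp [mem_owners, attrsList]
      rw [this]
      exact rep_one.congr fun _ _ => by simp
    · intro j v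
      simp [sat_nil]
  | cons r R ih =>
    simp only [List.map_cons, List.sum_cons, Constraint.occ] at hR
    obtain ⟨B, N, x, e, hx⟩ := ih fun a => (Nat.le_add_left _ _).trans (hR a)
    have hd : Disjoint (attrs r.lhs) (attrs r.rhs) := disjoint_attrs fun a =>
      (Nat.le_add_right _ _).trans (hR a)
    have hd' : Disjoint (attrs r.lhs ∪ attrs r.rhs) (attrsList R) := by
      rw [Finset.disjoint_left]
      intro a ha hb
      have h1 := occ_pos_of_mem_attrsList hb
      have h2 := hR a
      rw [Finset.mem_union, mem_attrs, mem_attrs] at ha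
      omega
    have hd'' := Finset.disjoint_union_left.1 hd'
    obtain ⟨B₁, N₁, y, e₁, hy⟩ := run_encFormula hα r.rhs
      (fun a => by have := hR a; omega) (attrsList R) _ hd''.2.symm
      (show (run (R.flatMap encConstraint) s).cands = _ by rw [e])
    obtain ⟨B₂, N₂, z, e₂, hz⟩ := run_encFormula hα r.lhs
      (fun a => by have := hR a; omega) (attrsList R ∪ attrs r.rhs) _
      (Finset.disjoint_union_left.2 ⟨hd''.1.symm, hd.symm⟩)
      (show (run (encFormula r.rhs) (run (R.flatMap encConstraint) s)).cands = _ by rw [e₁])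
    refine ⟨B₂, N₂, conTab (impTab z y) x, ?_, ?_⟩
    · have e3 : attrsList R ∪ attrs r.rhs ∪ attrs r.lhs = attrsList (r :: R) := by
        rw [attrsList, Finset.union_assoc, Finset.union_comm, Finset.union_comm (attrs r.rhs)]
      rw [List.flatMap_cons, encConstraint, run_append, run_cons, run_append, e₂, e₁, e, e3]
      rfl
    · rw [attrsList, owners_union, owners_union]
      have h1 := (hz.impTab hy (disjoint_owners hα hd)).conTab hx (by
        rw [← owners_union]
        exact disjoint_owners hα hd')
      refine h1.congr fun W hW => ?_
      rw [List.forall_mem_cons]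
      -- The products leave nested intersections with owner sets, which are removed one layer at a
      -- time.
      have i1 := holds_inter r.lhs (subset_rfl) (W ∩ (I.owners (attrs r.lhs) ∪ I.owners (attrs r.rhs)))
      have i2 := holds_inter r.rhs (subset_rfl) (W ∩ (I.owners (attrs r.lhs) ∪ I.owners (attrs r.rhs)))
      have i3 := holds_inter r.lhs
        (Z := I.owners (attrs r.lhs) ∪ I.owners (attrs r.rhs)) Finset.subset_union_left W
      have i4 := holds_inter r.rhs
        (Z := I.owners (attrs r.lhs) ∪ I.owners (attrs r.rhs)) Finset.subset_union_right W
      refine and_congr ?_ (forall₂_congr fun r' hr' => ?_)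
      · rw [i1, i2, i3, i4]
        rfl
      · exact constraint_holds_inter hr' W

/-- One register for the attribute suffices, as there is at most one; `cand` clears it for the next
candidate. -/
theorem run_encCandidate (hα : ∀ c, (I.α c).card ≤ 1) (c : Fin I.m) (s : St) (hs : s.attr = none) :
    ∃ B N p, run (encCandidate (I.α c) (I.S c)) s =
      ⟨B, N, none, p, I.candCode c :: s.cands, s.stk⟩ := by
  rcases eq_empty_or_eq_singleton (hα c) with h | ⟨b, h⟩
  · rw [encCandidate, run_cons, run_append, run_encInt]
    simp [h, run, step, candCode, hs]
  · rw [encCandidate, run_cons, run_append, run_encInt]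
    simp only [h, Finset.sort_singleton, List.flatMap_cons, List.flatMap_nil, List.append_nil,
      run_cons, run_encNat]
    simp [step, candCode, h]

theorem run_candidates (hα : ∀ c, (I.α c).card ≤ 1) (cs : List (Fin I.m)) :
    ∃ B N p, run (cs.flatMap fun c => encCandidate (I.α c) (I.S c)) .init =
      ⟨B, N, none, p, cs.map I.candCode, [([some ([], [])], [])]⟩ := by
  induction cs with
  | nil => exact ⟨_, _, _, rfl⟩
  | cons c cs ih =>
    obtain ⟨B, N, p, e⟩ := ih
    obtain ⟨B', N', p', e'⟩ := run_encCandidate hα c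
      (run (cs.flatMap fun c => encCandidate (I.α c) (I.S c)) .init) (by rw [e])
    refine ⟨B', N', p', ?_⟩
    rw [List.flatMap_cons, run_append, e', e]
    rfl

/-- The decision procedure is correct. -/
theorem answer_run_encode (hα : ∀ c, (I.α c).card ≤ 1) (hN : ∀ a, I.N a ≤ 1) :
    answer (run I.encode .init) = true ↔ I.IsYes := by
  obtain ⟨B, N, p, e⟩ := run_candidates hα (List.finRange I.m)
  have hc : (List.finRange I.m).map I.candCode = I.codes ∅ := by
    rw [codes, List.filter_eq_self.2]
    intro c _
    simp [mem_owners]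
  rw [hc] at e
  obtain ⟨B', N', x, e', hx⟩ := run_constraints hα I.R hN
    (run ((List.finRange I.m).flatMap fun c => encCandidate (I.α c) (I.S c)) .init)
    (by rw [e]) (by rw [e])
  -- The header is read last: the number of attributes stays in `bits`, and the two topmost entries
  -- of `nums` are `k` and `p`.
  rw [encode, run_append, run_append, run_append, run_append, e', run_encNat, run_encNat,
    run_encNat, answer, check_iff]
  simp only [List.head?_cons, Option.getD_some, List.tail_cons, val_encodeNat]
  -- Candidates without an attribute in the constraints are unrestricted, so any subset of them may
  -- be added.
  have h1 := I.rep_prodTab ((List.finRange I.m).filter fun c => c ∉ I.owners (attrsList I.R))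
    ((List.nodup_finRange _).filter _)
  have e1 : ((List.finRange I.m).filter fun c => c ∉ I.owners (attrsList I.R)).toFinset =
      (I.owners (attrsList I.R))ᶜ := by
    ext c
    simp
  have e2 : (I.codes (attrsList I.R)).map Prod.snd =
      ((List.finRange I.m).filter fun c => c ∉ I.owners (attrsList I.R)).map
        fun c => numOf (I.S c) := by
    rw [codes, List.map_map]
    rfl
  rw [e1, ← e2] at h1
  have h2 := hx.1.mul h1 disjoint_compl_right
  rw [h2, IsYes]
  refine exists_congr fun W => ?_
  have h3 : (∀ r ∈ I.R, r.Holds (I.assignment (W ∩ I.owners (attrsList I.R)))) ↔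
      ∀ r ∈ I.R, r.Holds (I.assignment W) :=
    forall₂_congr fun r hr => constraint_holds_inter hr W
  simp only [Finset.union_compl, Finset.subset_univ, true_and, and_true, h3, IsSolution]
  tauto

end Instance

/-! ### The Turing machine -/

/-- The symbols of the alphabet. -/
def allSym : List Sym :=
  [.bit false, .bit true, .fin, .plus, .minus, .pos, .neg, .and, .or, .imp, .cand, .attr]

theorem mem_allSym (x : Sym) : x ∈ allSym := by
  cases x with
  | bit b => cases b <;> simp [allSym]
  | _ => simp [allSym]

section

variable {Λ : Type}

/-- Push the bits of a list on the main stack. -/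
def pushAll (l : List Bool) (q : TM2.Stmt Alph Λ (Option Sym)) : TM2.Stmt Alph Λ (Option Sym) :=
  l.foldr (fun b q => .push (some .m) (fun _ => b) q) q

theorem stepAux_pushAll (l : List Bool) (q : TM2.Stmt Alph Λ (Option Sym)) (v : Option Sym)
    (w : List Sym) (s : Store) : TM2.stepAux (pushAll l q) v (contents w s) =
      TM2.stepAux q v (contents w (s.set .m (l.reverse ++ s.m))) := by
  induction l generalizing s with
  | nil => rfl
  | cons b l ih =>
    have h := ih (s.set .m (b :: s.m))
    have e : TM2.stepAux (pushAll (b :: l) q) v (contents w s) =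
        TM2.stepAux (pushAll l q) v (Function.update (contents w s) (some .m) (b :: s.m)) := rfl
    rw [e, contents_update, h, List.reverse_cons, List.append_assoc]
    rfl

/-- Push the code of the symbol in the internal state, provided that it is in the list. -/
def readSym (x : Λ) (l : List Sym) : TM2.Stmt Alph Λ (Option Sym) :=
  l.foldr (fun y q => .branch (fun v => v == some y)
    (pushAll (true :: (enc y).code).reverse (.goto fun _ => x)) q) (.goto fun _ => x)

theorem stepAux_readSym (x : Λ) (l : List Sym) (y : Sym) (hy : y ∈ l) (w : List Sym) (s : Store) :
    TM2.stepAux (readSym x l) (some y) (contents w s) =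
      ⟨some x, some y, contents w (s.set .m (true :: ((enc y).code ++ s.m)))⟩ := by
  induction l with
  | nil => simp at hy
  | cons z l ih =>
    have e : TM2.stepAux (readSym x (z :: l)) (some y) (contents w s) =
        cond (some y == some z) (TM2.stepAux (pushAll (true :: (enc z).code).reverse
          (.goto fun _ => x)) (some y) (contents w s))
          (TM2.stepAux (readSym x l) (some y) (contents w s)) := rfl
    rw [e]
    by_cases h : y = z
    · subst h
      rw [stepAux_pushAll, List.reverse_reverse]
      simp
    · have h' : (some y == some z) = false := by simpa using h
      rw [ih ((List.mem_cons.1 hy).resolve_left h), h', cond_false]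

end

/-- The statements of the machine that reads the input, runs a program, and writes the answer. -/
def machineStmt (p : Prog) : p.Lab ⊕ Fin 3 → TM2.Stmt Alph (p.Lab ⊕ Fin 3) (Option Sym)
  | Sum.inl l => p.compile Sum.inl (Sum.inr 2) l
  | Sum.inr 0 => .push (some .m) (fun _ => false) (.goto fun _ => Sum.inr 1)
  | Sum.inr 1 => .pop none (fun _ o => o) (.branch (fun v => v.isNone)
      (.goto fun _ => Sum.inl p.start) (readSym (Sum.inr 1) allSym))
  | Sum.inr 2 => .pop (some .m) (fun _ o => Option.map Sym.bit o) (.branch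
      (fun v => v == some (Sym.bit true))
      (.pop (some .m) (fun v _ => v) (.pop (some .m) (fun _ _ => none)
        (.push (some .m) (fun _ => true) .halt)))
      (.load (fun _ => none) (.push (some .m) (fun _ => false) .halt)))

/-- The machine that reads the input, runs a program, and writes the answer. -/
def machine (p : Prog) : FinTM2 where
  K := Option Reg
  k₀ := none
  k₁ := some .m
  Γ := Alph
  Λ := p.Lab ⊕ Fin 3
  main := Sum.inr 0
  σ := Option Sym
  initialState := none
  Γk₀Fin := inferInstanceAs (Fintype Sym)
  m := machineStmt p

theorem contents_update_input (w w' : List Sym) (s : Store) :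
    Function.update (contents w s) none w' = contents w' s := by
  funext k
  rcases k with _ | k
  · rw [Function.update_self]
    rfl
  · rw [Function.update_of_ne (by simp)]
    rfl

/-- Putting the symbols in front of a list one by one reverses the word, as the backward reading
requires. There is one step per symbol and one for noticing the end. -/
theorem reach_read (p : Prog) (w : List Sym) : ∀ (l : List Sym) (v : Option Sym),
    Reach (machineStmt p) (w.length + 1)
      ⟨some (Sum.inr 1), v, contents w ⟨(enc l).code, [], [], []⟩⟩
      ⟨some (Sum.inl p.start), none, contents [] ⟨(enc (w.reverse ++ l)).code, [], [], []⟩⟩ := by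
  induction w with
  | nil =>
    intro l v
    refine Reach.single ?_
    have e : TM2.stepAux (machineStmt p (Sum.inr 1)) v (contents [] ⟨(enc l).code, [], [], []⟩) =
        ⟨some (Sum.inl p.start), none,
          Function.update (contents [] ⟨(enc l).code, [], [], []⟩) none []⟩ := rfl
    rw [e, contents_update_input]
    rfl
  | cons x w ih =>
    intro l v
    have h := ih (x :: l) (some x)
    rw [List.length_cons, Nat.add_comm]
    rw [show (x :: w).reverse ++ l = w.reverse ++ x :: l by simp]
    refine Reach.trans (Reach.single ?_) h
    · have e : TM2.stepAux (machineStmt p (Sum.inr 1)) v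
          (contents (x :: w) ⟨(enc l).code, [], [], []⟩) =
          TM2.stepAux (readSym (Sum.inr 1) allSym) (some x)
          (Function.update (contents (x :: w) ⟨(enc l).code, [], [], []⟩) none w) := rfl
      rw [e, contents_update_input, stepAux_readSym _ _ _ (mem_allSym x)]
      have := code_cons_append x l []
      simp only [List.append_nil] at this
      rw [this]
      rfl

/-- The tree code of the answer becomes a single bit. The internal state is reset because a halting
configuration must carry the initial one. -/
theorem stepAux_finish (p : Prog) (b : Bool) (v : Option Sym) :
    TM2.stepAux (machineStmt p (Sum.inr 2)) v (contents [] ⟨(enc b).code, [], [], []⟩) =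
      ⟨none, none, contents [] ⟨[b], [], [], []⟩⟩ := by
  cases b with
  | false =>
    have e : TM2.stepAux (machineStmt p (Sum.inr 2)) v
        (contents [] ⟨(enc false).code, [], [], []⟩) =
        ⟨none, none, Function.update (Function.update (contents [] ⟨(enc false).code, [], [], []⟩)
          (some .m) []) (some .m) [false]⟩ := rfl
    rw [e, contents_update, contents_update]
    rfl
  | true =>
    have e : TM2.stepAux (machineStmt p (Sum.inr 2)) v
        (contents [] ⟨(enc true).code, [], [], []⟩) =
        ⟨none, none, Function.update (Function.update (Function.update (Function.update
          (contents [] ⟨(enc true).code, [], [], []⟩) (some .m) [false, false])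
          (some .m) [false]) (some .m) []) (some .m) [true]⟩ := rfl
    rw [e, contents_update, contents_update, contents_update, contents_update]
    rfl

theorem initList_machine (p : Prog) (w : List Sym) : initList (machine p) w =
    ⟨some (Sum.inr 0), none, contents w ⟨[], [], [], []⟩⟩ := by
  unfold initList
  congr 1
  funext k
  rcases k with _ | k
  · rfl
  · cases k <;> rfl

theorem haltList_machine (p : Prog) (b : Bool) : haltList (machine p) [b] =
    ⟨none, none, contents [] ⟨[b], [], [], []⟩⟩ := by
  unfold haltList
  congr 1
  funext k
  rcases k with _ | k
  · rfl
  · cases k <;> rfl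

theorem esize_word_le (w : List Sym) : esize w ≤ 25 * w.length + 1 := by
  have h : ∀ x : Sym, esize x ≤ 24 := by decide
  exact (esize_list_le w fun x _ => h x).trans (by omega)

open Classical in
/-- A language is decidable in polynomial time if some function on words, computable in polynomial
time, decides it on the reversed codes. -/
theorem solvableInPolyTime_of_pt {β : Type} {e : β → List Sym} {P Q : β → Prop}
    {f : List Sym → Bool} (hf : PT f) (h : ∀ x, P x → (f (e x).reverse = true ↔ Q x)) :
    SolvableInPolyTime e P Q := by
  obtain ⟨p, T, hp⟩ := hf
  -- A word of length `n` has a code of at most 25n + 1 bits, which is the argument of `T`. Reading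
  -- takes n + 1 steps, and there is one step each at the start and at the end.
  suffices key : ∀ x : {x // P x}, Nonempty (TM2OutputsInTime (machine p) (e x.1)
      (some [decide (Q x.1)]) ((T.comp (25 * .X + 1) + .X + 3).eval (e x.1).length)) by
    refine ⟨⟨⟨machine p, Equiv.refl _, Equiv.refl _⟩, T.comp (25 * .X + 1) + .X + 3, fun x => ?_⟩⟩
    have h1 : (e x.1).map (Equiv.refl Sym).invFun = e x.1 := List.map_id _
    exact h1.symm ▸ Classical.choice (key x)
  rintro ⟨x, hx⟩
  have h1 : Reach (machineStmt p) 1 ⟨some (Sum.inr 0), none, contents (e x) ⟨[], [], [], []⟩⟩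
      ⟨some (Sum.inr 1), none, contents (e x) ⟨(enc ([] : List Sym)).code, [], [], []⟩⟩ := by
    refine Reach.single ?_
    have e1 : TM2.stepAux (machineStmt p (Sum.inr 0)) none (contents (e x) ⟨[], [], [], []⟩) =
        ⟨some (Sum.inr 1), none, Function.update (contents (e x) ⟨[], [], [], []⟩) (some .m)
          [false]⟩ := rfl
    rw [e1, contents_update]
    rfl
  have h2 := reach_read p (e x) [] none
  obtain ⟨t, ht, h3⟩ := hp (e x).reverse []
  obtain ⟨v, h4⟩ := h3.reach (M := machineStmt p) Sum.inl (Sum.inr 2) (fun _ => rfl) [] none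
  have h5 : Reach (machineStmt p) 1
      ⟨some (Sum.inr 2), v, contents [] ⟨(enc (f (e x).reverse)).code, [], [], []⟩⟩ _ :=
    Reach.single (stepAux_finish p (f (e x).reverse) v)
  simp only [List.append_nil] at h2 h4
  have h6 := ((h1.trans h2).trans h4).trans h5
  have h7 : decide (Q x) = f (e x).reverse := by
    rw [Bool.eq_iff_iff, h x hx, decide_eq_true_iff]
  refine ⟨⟨⟨1 + ((e x).length + 1) + t + 1, ?_⟩, ?_⟩⟩
  · rw [initList_machine, Option.map_some, h7, haltList_machine]
    exact h6
  · have h8 := eval_mono T (esize_word_le (e x).reverse)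
    rw [List.length_reverse] at h8
    simp only [Polynomial.eval_add, Polynomial.eval_comp, Polynomial.eval_mul, Polynomial.eval_X,
      Polynomial.eval_ofNat, Polynomial.eval_one]
    omega

end CECAC

theorem theorem1 :
    CECAC.SolvableInPolyTime CECAC.Instance.encode
      (fun I => (∀ c, (I.α c).card ≤ 1) ∧ (∀ a, I.N a ≤ 1))
      CECAC.Instance.IsYes := by
  refine CECAC.solvableInPolyTime_of_pt CECAC.PT.decide_word fun I hI => ?_
  rw [List.foldl_reverse]
  exact CECAC.Instance.answer_run_encode hI.1 hI.2
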